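/- Let $0\le k\le i-1$ be integers, let $U=\mathbb F_2^i$, and let $V=\mathbb R^{2^i}$ with orthonormal basis $e_u$ ($u\in U$). For $a,b\in U$ define $X(a),Y(b)\in O(V)$ by $X(a)e_u=e_{u+a}$ and $Y(b)e_u=(-1)^{b\cdot u}e_u$, and let $E=\langle X(a),Y(b): a,b\in U\rangle\subset O(V)$, an extraspecial $2$-group of order $2^{2i+1}$ with center $\{\pm I\}$. Let $\bar E=E/\{\pm I\}$, a $2i$-dimensional vector space over $\mathbb F_2$, with the quadratic form $Q(\bar g)=0$ if $g^2=I$ and $Q(\bar g)=1$ if $g^2=-I$; a subspace $\bar S\subseteq\bar E$ is called totally singular if $Q$ vanishes on it. For a subgroup $S\subseteq E$, the invariant subspaces of $S$ here are the nonzero spaces among $V_\chi=\{v\in V: gv=\chi(g)v \text{ for all } g\in S\}$, where $\chi$ runs over the real linear characters $S\to\mathbb R^\times$. Let $L$ (the Clifford group) be the normalizer of $E$ in $O(V)$. Let $\mathcal P$ be the set of all invariant subspaces of the preimages $S\subseteq E$ of all $(i-k)$-dimensional totally singular subspaces $\bar S$ of $\bar E$. Then: (1) every member of $\mathcal P$ has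 dimension $2^k$, so $\mathcal P$ is a set of points of the Grassmannian $G(2^i,2^k)$ of $2^k$-dimensional subspaces of $V$; (2) $\mathcal P$ is finite and has exactly $$N=2^{i-k}\binom{i}{k}_2\prod_{j=k}^{i-1}(2^j+1),\qquad \binom{i}{k}_2=\frac{(2^i-1)(2^{i-1}-1)\cdots(2^{i-k+1}-1)}{(2^k-1)(2^{k-1}-1)\cdots(2-1)},$$ elements; (3) the minimal chordal distance $d_c(P,P')$ between distinct members $P,P'$ of $\mathcal P$ is (attained and equal to) $2^{(k-1)/2}$, where $d_c(P,P')=\sqrt{\sin^2\theta_1+\cdots+\sin^2\theta_n}$, with $n=2^k$ and $\theta_1,\dots,\theta_n\in[0,\pi/2]$ the principal angles between $P$ and $P'$; (4) $\mathcal P$ is the orbit under $L$ of the $2^k$-dimensional coordinate space spanned by those $e_u$ for which the first $i-k$ coordinates of $u$ are zero. -/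

import Mathlib

namespace GrassmannPacking

open scoped InnerProductSpace

section Grassmannian

variable {W : Type*} [NormedAddCommGroup W] [InnerProductSpace ℝ W]

/-- The Grassmannian `G(W, n)`: all `n`-dimensional linear subspaces of `W`. -/
def Gr (W : Type*) [NormedAddCommGroup W] [InnerProductSpace ℝ W] (n : ℕ) : Type _ :=
  {P : Submodule ℝ W // Module.finrank ℝ P = n}

/-- `(x, y)` is an admissible pair for choosing the principal vectors number `j`:
unit vectors `x ∈ P`, `y ∈ Q`, orthogonal to the earlier `u l`, respectively `v l`. -/
def Admissible (P Q : Submodule ℝ W) {m : ℕ} (u v : Fin m → W) (j : Fin m) (x y : W) : Prop :=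
  x ∈ P ∧ y ∈ Q ∧ ‖x‖ = 1 ∧ ‖y‖ = 1 ∧ ∀ l < j, ⟪x, u l⟫_ℝ = 0 ∧ ⟪y, v l⟫_ℝ = 0

/-- `u` and `v` are principal vectors of the pair `P`, `Q`: for each `j`, the pair `(u j, v j)`
is admissible and maximizes the inner product among all admissible pairs. -/
def IsPrincipalVectors (P Q : Submodule ℝ W) {m : ℕ} (u v : Fin m → W) : Prop :=
  ∀ j, Admissible P Q u v j (u j) (v j) ∧
    ∀ x y, Admissible P Q u v j x y → ⟪x, y⟫_ℝ ≤ ⟪u j, v j⟫_ℝ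

theorem exists_unit_perp {n m : ℕ} (P : Submodule ℝ W) (hP : Module.finrank ℝ P = n)
    (hm : m < n) (u : ℕ → W) : ∃ x ∈ P, ‖x‖ = 1 ∧ ∀ l < m, ⟪x, u l⟫_ℝ = 0 := by
  have hfd : FiniteDimensional ℝ P := Module.finite_of_finrank_pos (by omega)
  let f : P →ₗ[ℝ] (Fin m → ℝ) :=
    LinearMap.pi fun l => (innerₛₗ ℝ (u l)).comp P.subtype
  have hker : LinearMap.ker f ≠ ⊥ := by
    apply LinearMap.ker_ne_bot_of_finrank_lt
    simp [hP, hm]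
  obtain ⟨x, hx, hx0⟩ := Submodule.exists_mem_ne_zero_of_ne_bot hker
  have hx0' : (x : W) ≠ 0 := by simpa using hx0
  refine ⟨(‖(x : W)‖⁻¹ : ℝ) • (x : W), P.smul_mem _ x.2, norm_smul_inv_norm hx0', ?_⟩
  intro l hl
  have h := congrFun (LinearMap.mem_ker.1 hx) ⟨l, hl⟩
  have h' : ⟪u l, (x : W)⟫_ℝ = 0 := by simpa [f] using h
  rw [inner_smul_left, real_inner_comm, h', mul_zero]

theorem isCompact_unit_perp {n m : ℕ} (P : Submodule ℝ W) (hP : Module.finrank ℝ P = n)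
    (hm : m < n) (u : ℕ → W) :
    IsCompact {x : W | x ∈ P ∧ ‖x‖ = 1 ∧ ∀ l < m, ⟪x, u l⟫_ℝ = 0} := by
  have hfd : FiniteDimensional ℝ P := Module.finite_of_finrank_pos (by omega)
  have h1 : IsCompact (P.subtype '' Metric.sphere (0 : P) 1) :=
    (isCompact_sphere (0 : P) 1).image continuous_subtype_val
  have h2 : IsClosed {x : W | ∀ l < m, ⟪x, u l⟫_ℝ = 0} := by
    simp only [Set.ofPred_forall]
    exact isClosed_iInter fun l => isClosed_iInter fun _ =>
      isClosed_eq (by fun_prop) continuous_const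
  convert h1.inter_right h2 using 1
  ext x
  constructor
  · rintro ⟨a, b, c⟩
    exact ⟨⟨⟨x, a⟩, by simpa using b, rfl⟩, c⟩
  · rintro ⟨⟨y, hy, rfl⟩, c⟩
    exact ⟨y.2, by simpa using hy, c⟩

/-- Principal vectors exist for any two `n`-dimensional subspaces. -/
theorem exists_isPrincipalVectors {n : ℕ} (P Q : Submodule ℝ W) (hP : Module.finrank ℝ P = n)
    (hQ : Module.finrank ℝ Q = n) : ∃ u v : Fin n → W, IsPrincipalVectors P Q u v := by
  suffices H : ∀ m ≤ n, ∃ u v : ℕ → W,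
      IsPrincipalVectors P Q (fun j : Fin m => u j) (fun j : Fin m => v j) by
    obtain ⟨u, v, h⟩ := H n le_rfl
    exact ⟨_, _, h⟩
  intro m
  induction m with
  | zero => exact fun _ => ⟨0, 0, fun j => j.elim0⟩
  | succ m ih =>
    intro hm
    obtain ⟨u, v, h⟩ := ih (by omega)
    have hK := (isCompact_unit_perp P hP hm u).prod (isCompact_unit_perp Q hQ hm v)
    obtain ⟨x₀, hx₀⟩ := exists_unit_perp P hP hm u
    obtain ⟨y₀, hy₀⟩ := exists_unit_perp Q hQ hm v
    obtain ⟨⟨x, y⟩, ⟨hx, hy⟩, hmax⟩ := hK.exists_isMaxOn ⟨(x₀, y₀), hx₀, hy₀⟩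
      (f := fun z : W × W => ⟪z.1, z.2⟫_ℝ) (by fun_prop)
    have hlt : ∀ (w : ℕ → W) (z : W) (l : ℕ), l < m → Function.update w m z l = w l :=
      fun w z l hl => Function.update_of_ne hl.ne z w
    refine ⟨Function.update u m x, Function.update v m y, fun ⟨j, hj⟩ => ?_⟩
    rcases (Nat.lt_succ_iff_lt_or_eq.1 hj) with hj' | rfl
    · have e : ∀ a b, Admissible P Q (fun j : Fin (m + 1) => Function.update u m x j)
          (fun j : Fin (m + 1) => Function.update v m y j) ⟨j, hj⟩ a b ↔
          Admissible P Q (fun j : Fin m => u j) (fun j : Fin m => v j) ⟨j, hj'⟩ a b := by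
        intro a b
        refine and_congr_right fun _ => and_congr_right fun _ => and_congr_right fun _ =>
          and_congr_right fun _ => ?_
        constructor
        · intro H l hl
          have hl' : (l : ℕ) < j := hl
          have := H ⟨l, by omega⟩ hl
          simpa [hlt _ _ l l.2] using this
        · intro H l hl
          have hl' : (l : ℕ) < j := hl
          have := H ⟨l, by omega⟩ hl
          simpa [hlt _ _ l (by omega)] using this
      simp only [e, hlt _ _ j hj']
      exact h ⟨j, hj'⟩
    · have e : ∀ a b, Admissible P Q (fun i : Fin (j + 1) => Function.update u j x i)
          (fun i : Fin (j + 1) => Function.update v j y i) ⟨j, hj⟩ a b ↔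
          (a ∈ P ∧ ‖a‖ = 1 ∧ ∀ l < j, ⟪a, u l⟫_ℝ = 0) ∧
          (b ∈ Q ∧ ‖b‖ = 1 ∧ ∀ l < j, ⟪b, v l⟫_ℝ = 0) := by
        intro a b
        have : (∀ l : Fin (j + 1), l < ⟨j, hj⟩ →
            ⟪a, Function.update u j x l⟫_ℝ = 0 ∧ ⟪b, Function.update v j y l⟫_ℝ = 0) ↔
            ∀ l < j, ⟪a, u l⟫_ℝ = 0 ∧ ⟪b, v l⟫_ℝ = 0 := by
          constructor
          · intro H l hl
            simpa [hlt _ _ l hl] using H ⟨l, by omega⟩ hl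
          · intro H l hl
            have hl' : (l : ℕ) < j := hl
            simpa [hlt _ _ l hl'] using H l hl'
        unfold Admissible
        rw [this]
        constructor
        · rintro ⟨a1, a2, a3, a4, a5⟩
          exact ⟨⟨a1, a3, fun l hl => (a5 l hl).1⟩, a2, a4, fun l hl => (a5 l hl).2⟩
        · rintro ⟨⟨a1, a3, a5⟩, a2, a4, a6⟩
          exact ⟨a1, a2, a3, a4, fun l hl => ⟨a5 l hl, a6 l hl⟩⟩
      simp only [e, Function.update_self]
      exact ⟨⟨hx, hy⟩, fun a b hab => hmax (a := (a, b)) hab⟩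

variable {n : ℕ}

/-- Principal vectors of a pair of `n`-spaces. -/
noncomputable def principalVectors (P Q : Gr W n) : (Fin n → W) × (Fin n → W) :=
  ⟨(exists_isPrincipalVectors P.1 Q.1 P.2 Q.2).choose,
    (exists_isPrincipalVectors P.1 Q.1 P.2 Q.2).choose_spec.choose⟩

theorem principalVectors_spec (P Q : Gr W n) :
    IsPrincipalVectors P.1 Q.1 (principalVectors P Q).1 (principalVectors P Q).2 :=
  (exists_isPrincipalVectors P.1 Q.1 P.2 Q.2).choose_spec.choose_spec

/-- The principal angles `θ_j ∈ [0, π/2]`, with `cos θ_j = u_j · v_j`. -/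
noncomputable def principalAngle (P Q : Gr W n) (j : Fin n) : ℝ :=
  Real.arccos ⟪(principalVectors P Q).1 j, (principalVectors P Q).2 j⟫_ℝ

/-- The chordal distance `√(sin² θ_1 + ⋯ + sin² θ_n)`. -/
noncomputable def chordalDist (P Q : Gr W n) : ℝ :=
  Real.sqrt (∑ j, Real.sin (principalAngle P Q j) ^ 2)

theorem IsPrincipalVectors.orthonormal {P Q : Submodule ℝ W} {m : ℕ} {u v : Fin m → W}
    (h : IsPrincipalVectors P Q u v) : Orthonormal ℝ u ∧ Orthonormal ℝ v := by
  refine ⟨⟨fun j => (h j).1.2.2.1, fun j l hjl => ?_⟩, ⟨fun j => (h j).1.2.2.2.1,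
    fun j l hjl => ?_⟩⟩
  · rcases lt_or_gt_of_ne hjl with hl | hl
    · rw [real_inner_comm]; exact ((h l).1.2.2.2.2 j hl).1
    · exact ((h j).1.2.2.2.2 l hl).1
  · rcases lt_or_gt_of_ne hjl with hl | hl
    · rw [real_inner_comm]; exact ((h l).1.2.2.2.2 j hl).2
    · exact ((h j).1.2.2.2.2 l hl).2

theorem eq_zero_of_forall_unit_le {c d : ℝ}
    (h : ∀ a b : ℝ, a ^ 2 + b ^ 2 = 1 → a * c + b * d ≤ c) : d = 0 := by
  by_contra hd
  have hpos : 0 < c ^ 2 + d ^ 2 := by positivity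
  set r := Real.sqrt (c ^ 2 + d ^ 2) with hr
  have hr2 : r ^ 2 = c ^ 2 + d ^ 2 := Real.sq_sqrt hpos.le
  have hr0 : 0 < r := Real.sqrt_pos.2 hpos
  have h1 := h (c / r) (d / r) (by rw [div_pow, div_pow, ← add_div, hr2, div_self hpos.ne'])
  have h2 : c / r * c + d / r * d = r := by
    field_simp
    linarith
  rw [h2] at h1
  have : 0 < d ^ 2 := by positivity
  nlinarith

theorem norm_comb_eq_one {x y : W} (hx : ‖x‖ = 1) (hy : ‖y‖ = 1) (hxy : ⟪x, y⟫_ℝ = 0)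
    {a b : ℝ} (hab : a ^ 2 + b ^ 2 = 1) : ‖a • x + b • y‖ = 1 := by
  have : ‖a • x + b • y‖ ^ 2 = 1 := by
    rw [norm_add_sq_real, norm_smul, norm_smul, inner_smul_left, inner_smul_right, hxy, hx, hy]
    simp [hab]
  exact (pow_eq_one_iff_of_nonneg (norm_nonneg _) two_ne_zero).1 this

theorem IsPrincipalVectors.inner_eq_zero {P Q : Submodule ℝ W} {m : ℕ} {u v : Fin m → W}
    (h : IsPrincipalVectors P Q u v) {j l : Fin m} (hjl : j < l) :
    ⟪u j, v l⟫_ℝ = 0 ∧ ⟪u l, v j⟫_ℝ = 0 := by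
  obtain ⟨hu, hv⟩ := h.orthonormal
  obtain ⟨⟨a1, a2, a3, a4, a5⟩, hmax⟩ := h j
  obtain ⟨⟨b1, b2, b3, b4, b5⟩, -⟩ := h l
  constructor
  · refine eq_zero_of_forall_unit_le (c := ⟪u j, v j⟫_ℝ) fun a b hab => ?_
    have := hmax (u j) (a • v j + b • v l) ⟨a1, Q.add_mem (Q.smul_mem _ a2) (Q.smul_mem _ b2), a3,
      norm_comb_eq_one a4 b4 (hv.2 hjl.ne) hab, fun t ht => ⟨(a5 t ht).1, by
        rw [inner_add_left, inner_smul_left, inner_smul_left, (a5 t ht).2,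
          (b5 t (ht.trans hjl)).2]; simp⟩⟩
    simpa [inner_add_right, inner_smul_right] using this
  · refine eq_zero_of_forall_unit_le (c := ⟪u j, v j⟫_ℝ) fun a b hab => ?_
    have := hmax (a • u j + b • u l) (v j) ⟨P.add_mem (P.smul_mem _ a1) (P.smul_mem _ b1), a2,
      norm_comb_eq_one a3 b3 (hu.2 hjl.ne) hab, a4, fun t ht => ⟨by
        rw [inner_add_left, inner_smul_left, inner_smul_left, (a5 t ht).1,
          (b5 t (ht.trans hjl)).1]; simp, (a5 t ht).2⟩⟩
    simpa [inner_add_left, inner_smul_left] using this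

theorem sum_inner_sq_eq {P : Submodule ℝ W} (hP : Module.finrank ℝ P = n) {u u' : Fin n → W}
    (hu : Orthonormal ℝ u) (hu' : Orthonormal ℝ u') (huP : ∀ j, u j ∈ P) (huP' : ∀ j, u' j ∈ P)
    (y : W) : ∑ j, ⟪u j, y⟫_ℝ ^ 2 = ∑ j, ⟪u' j, y⟫_ℝ ^ 2 := by
  rcases Nat.eq_zero_or_pos n with rfl | hn
  · simp
  have hfd : FiniteDimensional ℝ P := Module.finite_of_finrank_pos (by omega)
  have key : ∀ w : Fin n → W, Orthonormal ℝ w → (∀ j, w j ∈ P) →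
      ∑ j, ⟪w j, y⟫_ℝ ^ 2 = ‖P.orthogonalProjectionOnto y‖ ^ 2 := by
    intro w hw hwP
    let w' : Fin n → P := fun j => ⟨w j, hwP j⟩
    have hw' : Orthonormal ℝ w' := ⟨fun j => hw.1 j, fun j l hjl => hw.2 hjl⟩
    have hspan := hw'.linearIndependent.span_eq_top_of_card_eq_finrank' (by simp [hP])
    rw [← (OrthonormalBasis.mk hw' hspan.ge).sum_sq_norm_inner_right]
    refine Finset.sum_congr rfl fun j _ => ?_
    rw [OrthonormalBasis.coe_mk, Real.norm_eq_abs, sq_abs, Submodule.coe_inner]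
    congr 1
    exact (Submodule.inner_orthogonalProjectionOnto_eq_of_mem_left (w' j) y).symm
  rw [key u hu huP, key u' hu' huP']

theorem IsPrincipalVectors.sum_sin_sq {P Q : Submodule ℝ W} {m : ℕ} {u v : Fin m → W}
    (h : IsPrincipalVectors P Q u v) :
    ∑ j, Real.sin (Real.arccos ⟪u j, v j⟫_ℝ) ^ 2 = m - ∑ j, ∑ l, ⟪u l, v j⟫_ℝ ^ 2 := by
  have : ∀ j, Real.sin (Real.arccos ⟪u j, v j⟫_ℝ) ^ 2 = 1 - ∑ l, ⟪u l, v j⟫_ℝ ^ 2 := by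
    intro j
    rw [Finset.sum_eq_single j]
    · rw [Real.sin_arccos, Real.sq_sqrt]
      have := abs_real_inner_le_norm (u j) (v j)
      rw [(h j).1.2.2.1, (h j).1.2.2.2.1, mul_one, ← sq_le_one_iff_abs_le_one] at this
      linarith
    · intro l _ hl
      rcases lt_or_gt_of_ne hl with hl | hl
      · rw [(h.inner_eq_zero hl).1]; simp
      · rw [(h.inner_eq_zero hl).2]; simp
    · simp
  simp [this]

/-- The chordal distance does not depend on the choice of the principal vectors. -/
theorem chordalDist_eq (P Q : Gr W n) {u v : Fin n → W} (h : IsPrincipalVectors P.1 Q.1 u v) :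
    chordalDist P Q = Real.sqrt (∑ j, Real.sin (Real.arccos ⟪u j, v j⟫_ℝ) ^ 2) := by
  have h' := principalVectors_spec P Q
  unfold chordalDist principalAngle
  rw [h'.sum_sin_sq, h.sum_sin_sq]
  congr 2
  set u' := (principalVectors P Q).1
  set v' := (principalVectors P Q).2
  calc ∑ j, ∑ l, ⟪u' l, v' j⟫_ℝ ^ 2
      = ∑ j, ∑ l, ⟪u l, v' j⟫_ℝ ^ 2 := Finset.sum_congr rfl fun j _ =>
        sum_inner_sq_eq P.2 h'.orthonormal.1 h.orthonormal.1 (fun j => (h' j).1.1)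
          (fun j => (h j).1.1) _
    _ = ∑ l, ∑ j, ⟪v' j, u l⟫_ℝ ^ 2 := by
        rw [Finset.sum_comm]
        exact Finset.sum_congr rfl fun l _ => Finset.sum_congr rfl fun j _ => by
          rw [real_inner_comm]
    _ = ∑ l, ∑ j, ⟪v j, u l⟫_ℝ ^ 2 := Finset.sum_congr rfl fun l _ =>
        sum_inner_sq_eq Q.2 h'.orthonormal.2 h.orthonormal.2 (fun j => (h' j).1.2.1)
          (fun j => (h j).1.2.1) _
    _ = ∑ j, ∑ l, ⟪u l, v j⟫_ℝ ^ 2 := by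
        rw [Finset.sum_comm]
        exact Finset.sum_congr rfl fun l _ => Finset.sum_congr rfl fun j _ => by
          rw [real_inner_comm]

end Grassmannian

section Clifford

/-- The index set `U = 𝔽₂^i`. -/
abbrev U (i : ℕ) : Type := Fin i → ZMod 2

/-- The parent space `V = ℝ^(2^i)`, with orthonormal basis `e u`, `u ∈ U`. -/
abbrev V (i : ℕ) : Type := EuclideanSpace ℝ (U i)

/-- The real orthogonal group `O(V)`. -/
abbrev O (i : ℕ) : Type := V i ≃ₗᵢ[ℝ] V i

variable {i : ℕ}

/-- The coordinate vectors. -/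
noncomputable def e (u : U i) : V i := EuclideanSpace.single u 1

/-- The sign `(-1)^t`, for `t ∈ 𝔽₂`. -/
def sgn (t : ZMod 2) : ℝ := if t = 0 then 1 else -1

/-- `X(a) : e_u ↦ e_(u+a)`. -/
noncomputable def X (a : U i) : O i :=
  LinearIsometryEquiv.piLpCongrLeft 2 ℝ ℝ (Equiv.addRight a)

/-- `Y(b) : e_u ↦ (-1)^(b·u) e_u`. -/
noncomputable def Y (b : U i) : O i :=
  LinearIsometryEquiv.piLpCongrRight 2 fun u =>
    if b ⬝ᵥ u = 0 then LinearIsometryEquiv.refl ℝ ℝ else LinearIsometryEquiv.neg ℝ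

/-- The extraspecial `2`-group `E = ⟨X(a), Y(b)⟩`. -/
noncomputable def E (i : ℕ) : Subgroup (O i) :=
  Subgroup.closure (Set.range X ∪ Set.range Y)

theorem sub_eq_add_U (u a : U i) : u - a = u + a := by
  funext j
  exact CharTwo.sub_eq_add _ _

theorem X_coord (a : U i) (v : V i) (u : U i) : X a v u = v (u + a) := by
  rw [← sub_eq_add_U, sub_eq_add_neg]
  simp [X, LinearIsometryEquiv.piLpCongrLeft_apply, Equiv.piCongrLeft']

theorem Y_coord (b : U i) (v : V i) (u : U i) : Y b v u = sgn (b ⬝ᵥ u) * v u := by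
  simp only [Y, LinearIsometryEquiv.piLpCongrRight_apply, sgn]
  split_ifs <;> simp

theorem X_e (a u : U i) : X a (e u) = e (u + a) := by
  simp [X, e]

theorem Y_e (b u : U i) : Y b (e u) = sgn (b ⬝ᵥ u) • e u := by
  ext w
  rw [Y_coord]
  by_cases h : w = u
  · subst h; simp [e]
  · simp [e, h]

theorem sgn_add (s t : ZMod 2) : sgn (s + t) = sgn s * sgn t := by
  have h : ∀ x : ZMod 2, x = 0 ∨ x = 1 := by decide
  have h11 : (1 : ZMod 2) + 1 = 0 := by decide
  rcases h s with rfl | rfl <;> rcases h t with rfl | rfl <;> simp [sgn, h11]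

theorem sgn_mul_self (s : ZMod 2) : sgn s * sgn s = 1 := by
  unfold sgn; split_ifs <;> norm_num

theorem sgn_inj {s t : ZMod 2} (h : sgn s = sgn t) : s = t := by
  have hx : ∀ x : ZMod 2, x = 0 ∨ x = 1 := by decide
  rcases hx s with rfl | rfl <;> rcases hx t with rfl | rfl <;> simp [sgn] at h ⊢ <;>
    norm_num at h

theorem add_add_self_U (u a : U i) : u + a + a = u := by
  rw [← sub_eq_add_U (u + a) a, add_sub_cancel_right]

/-- Every element of `E` has the form `±X(a)Y(b)`, written here in coordinates. -/
theorem E_form {g : O i} (hg : g ∈ E i) :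
    ∃ (s : ZMod 2) (a b : U i), ∀ v u, g v u = sgn (s + b ⬝ᵥ u) * v (u + a) := by
  unfold E at hg
  induction hg using Subgroup.closure_induction with
  | mem x hx =>
    rcases hx with ⟨a, rfl⟩ | ⟨b, rfl⟩
    · exact ⟨0, a, 0, fun v u => by rw [X_coord]; simp [sgn]⟩
    · exact ⟨0, 0, b, fun v u => by rw [Y_coord]; simp⟩
  | one => exact ⟨0, 0, 0, fun v u => by simp [sgn]⟩
  | mul x y _ _ hx hy =>
    obtain ⟨s, a, b, h⟩ := hx
    obtain ⟨s', a', b', h'⟩ := hy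
    refine ⟨s + s' + b' ⬝ᵥ a, a + a', b + b', fun v u => ?_⟩
    change x (y v) u = _
    rw [h, h', ← mul_assoc, ← sgn_add, dotProduct_add,
      add_dotProduct, add_assoc u]
    congr 2
    ring
  | inv x _ hx =>
    obtain ⟨s, a, b, h⟩ := hx
    refine ⟨s + b ⬝ᵥ a, a, b, fun v u => ?_⟩
    have hv : x (x⁻¹ v) = v := x.apply_symm_apply v
    have := h (x⁻¹ v) (u + a)
    rw [hv, add_add_self_U, dotProduct_add] at this
    rw [this, ← mul_assoc, ← sgn_add]
    have : s + b ⬝ᵥ a + b ⬝ᵥ u + (s + (b ⬝ᵥ u + b ⬝ᵥ a)) = 0 := by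
      have := CharTwo.add_self_eq_zero (s + b ⬝ᵥ a + b ⬝ᵥ u)
      rw [← this]; ring
    rw [this]
    simp [sgn]

/-- The center of `E` consists of `±I`. -/
theorem center_form {z : E i} (hz : z ∈ Subgroup.center (E i)) :
    ∃ s : ZMod 2, ∀ v, (z : O i) v = sgn s • v := by
  obtain ⟨s, a, b, h⟩ := E_form z.2
  have hX : ∀ c : U i, X c ∈ E i := fun c => Subgroup.subset_closure (Or.inl ⟨c, rfl⟩)
  have hY : ∀ c : U i, Y c ∈ E i := fun c => Subgroup.subset_closure (Or.inr ⟨c, rfl⟩)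
  have hcomm : ∀ g ∈ E i, ∀ v, (g : O i) ((z : O i) v) = (z : O i) (g v) := fun g hg v =>
    DFunLike.congr_fun (congrArg Subtype.val (Subgroup.mem_center_iff.1 hz ⟨g, hg⟩)) v
  let one : V i := WithLp.toLp 2 fun _ => 1
  have hone : ∀ u, one u = 1 := fun _ => rfl
  have ha : a = 0 := by
    refine dotProduct_eq_zero a fun c => ?_
    have := congrArg (fun w : V i => w 0) (hcomm _ (hY c) one)
    simp only [h, Y_coord, hone, dotProduct_zero, zero_add, mul_one] at this
    have h0 : sgn 0 = 1 := by simp [sgn]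
    rw [h0, one_mul, ← sgn_add] at this
    have := sgn_inj this
    rw [dotProduct_comm]
    simpa using this
  have hb : b = 0 := by
    refine dotProduct_eq_zero b fun c => ?_
    have := congrArg (fun w : V i => w 0) (hcomm _ (hX c) one)
    simp only [h, X_coord, hone, dotProduct_zero, zero_add, mul_one] at this
    have := sgn_inj this
    simpa using this
  refine ⟨s, fun v => ?_⟩
  ext u
  rw [h, ha, hb]
  simp

theorem mem_center_of_form {z : E i} {s : ZMod 2} (h : ∀ v, (z : O i) v = sgn s • v) :
    z ∈ Subgroup.center (E i) := by
  rw [Subgroup.mem_center_iff]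
  intro g
  apply Subtype.ext
  apply LinearIsometryEquiv.ext
  intro v
  change (g : O i) ((z : O i) v) = (z : O i) ((g : O i) v)
  rw [h, h, map_smul]

theorem mk_eq_of_form {g g' : E i} {s : ZMod 2}
    (h : ∀ v, (g : O i) v = sgn s • (g' : O i) v) :
    (QuotientGroup.mk g : E i ⧸ Subgroup.center (E i)) = QuotientGroup.mk g' := by
  rw [eq_comm, QuotientGroup.eq]
  refine mem_center_of_form (s := s) fun v => ?_
  change (g' : O i)⁻¹ ((g : O i) v) = _
  rw [h, map_smul]
  congr 1
  exact (g' : O i).symm_apply_apply v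

theorem sq_form (g : E i) : ∃ s : ZMod 2, ∀ v, ((g * g : E i) : O i) v = sgn s • v := by
  obtain ⟨s, a, b, h⟩ := E_form g.2
  refine ⟨b ⬝ᵥ a, fun v => ?_⟩
  ext u
  change (g : O i) ((g : O i) v) u = sgn (b ⬝ᵥ a) * v u
  rw [h, h, add_add_self_U, ← mul_assoc, ← sgn_add, dotProduct_add]
  have : s + b ⬝ᵥ u + (s + (b ⬝ᵥ u + b ⬝ᵥ a)) = b ⬝ᵥ a := by
    have := CharTwo.add_self_eq_zero (s + b ⬝ᵥ u)
    linear_combination this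
  rw [this]

theorem comm_form (g g' : E i) : ∃ s : ZMod 2, ∀ v,
    ((g * g' : E i) : O i) v = sgn s • ((g' * g : E i) : O i) v := by
  obtain ⟨s, a, b, h⟩ := E_form g.2
  obtain ⟨s', a', b', h'⟩ := E_form g'.2
  refine ⟨b' ⬝ᵥ a + b ⬝ᵥ a', fun v => ?_⟩
  ext u
  change (g : O i) ((g' : O i) v) u = sgn _ * (g' : O i) ((g : O i) v) u
  rw [h, h', h', h, ← mul_assoc, ← mul_assoc, ← mul_assoc, ← sgn_add, ← sgn_add, ← sgn_add,
    dotProduct_add, dotProduct_add, add_right_comm u a' a]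
  congr 2
  have := CharTwo.add_self_eq_zero (b ⬝ᵥ a')
  linear_combination -this

/-- The quotient `Ē = E / Ξ(E)` of `E` by its center, an elementary abelian `2`-group, written
additively and regarded as a vector space over `𝔽₂`. -/
def EBar (i : ℕ) : Type := Additive (E i ⧸ Subgroup.center (E i))

/-- The homomorphism `g ↦ ḡ` from `E` to `Ē`. -/
noncomputable def bar (g : E i) : EBar i := Additive.ofMul (QuotientGroup.mk g)

noncomputable instance : AddCommGroup (EBar i) :=
  { (inferInstance : AddGroup (Additive (E i ⧸ Subgroup.center (E i)))) with
    add_comm := by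
      intro x y
      induction x using QuotientGroup.induction_on with | _ g
      induction y using QuotientGroup.induction_on with | _ g'
      obtain ⟨s, hs⟩ := comm_form g g'
      exact mk_eq_of_form hs }

theorem bar_mul (g g' : E i) : bar (g * g') = bar g + bar g' := rfl

theorem bar_one : bar (1 : E i) = 0 := rfl

theorem bar_inv (g : E i) : bar g⁻¹ = -bar g := rfl

theorem two_nsmul_EBar (x : EBar i) : 2 • x = 0 := by
  rw [two_nsmul]
  induction x using QuotientGroup.induction_on with | _ g
  obtain ⟨s, hs⟩ := sq_form g
  exact mk_eq_of_form (g := g * g) (g' := 1) hs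

noncomputable instance : Module (ZMod 2) (EBar i) :=
  AddCommGroup.zmodModule two_nsmul_EBar

open Classical in
/-- The quadratic form: `Q(ḡ) = 0` if `g² = I`, and `Q(ḡ) = 1` otherwise, that is, if
`g² = -I`. -/
noncomputable def Q : EBar i → ZMod 2 :=
  Quotient.lift (s := QuotientGroup.leftRel (Subgroup.center (E i)))
    (fun g : E i => if g ^ 2 = 1 then 0 else 1) (by
      intro g g' hgg'
      obtain ⟨s, hs⟩ := center_form (QuotientGroup.leftRel_apply.1 hgg')
      have hg' : ∀ v, (g' : O i) v = sgn s • (g : O i) v := by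
        intro v
        rw [← map_smul, ← hs]
        change _ = (g : O i) ((g : O i)⁻¹ ((g' : O i) v))
        exact ((g : O i).apply_symm_apply _).symm
      have : g ^ 2 = g' ^ 2 := by
        rw [sq, sq]
        apply Subtype.ext
        apply LinearIsometryEquiv.ext
        intro v
        change (g : O i) ((g : O i) v) = (g' : O i) ((g' : O i) v)
        rw [hg', hg', map_smul, smul_smul, sgn_mul_self, one_smul]
      simp only [this])

open Classical in
theorem Q_bar (g : E i) : Q (bar g) = if g ^ 2 = 1 then 0 else 1 := rfl

/-- For `g ∈ E`, either `g² = I` or `g² = -I`. -/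
theorem sq_eq_one_or_neg (g : E i) :
    ((g ^ 2 : E i) : O i) = 1 ∨ ((g ^ 2 : E i) : O i) = LinearIsometryEquiv.neg ℝ := by
  obtain ⟨s, hs⟩ := sq_form g
  rw [← sq] at hs
  by_cases h : s = 0
  · left
    apply LinearIsometryEquiv.ext
    intro v
    rw [hs, h]; simp [sgn]
  · right
    apply LinearIsometryEquiv.ext
    intro v
    rw [hs]; simp [sgn, h]

/-- A subspace of `Ē` is totally singular if `Q` vanishes on it. -/
def IsTotallySingular (S : Submodule (ZMod 2) (EBar i)) : Prop := ∀ x ∈ S, Q x = 0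

/-- The preimage in `E` of a subspace of `Ē`. -/
def preimage (S : Submodule (ZMod 2) (EBar i)) : Subgroup (E i) where
  carrier := {g | bar g ∈ S}
  mul_mem' := fun {g g'} h h' => by
    rw [Set.mem_ofPred_eq, bar_mul]; exact S.add_mem h h'
  one_mem' := by rw [Set.mem_ofPred_eq, bar_one]; exact S.zero_mem
  inv_mem' := fun {g} h => by rw [Set.mem_ofPred_eq, bar_inv]; exact S.neg_mem h

/-- The space of all `v ∈ V` on which the subgroup `S` of `E` acts through the linear
character `χ`. -/
def charSpace (S : Subgroup (E i)) (χ : S →* ℝˣ) : Submodule ℝ (V i) where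
  carrier := {v | ∀ g : S, ((g : E i) : O i) v = (χ g : ℝ) • v}
  add_mem' := fun {v w} hv hw g => by rw [map_add, hv g, hw g, smul_add]
  zero_mem' := fun g => by simp
  smul_mem' := fun c v hv g => by rw [map_smul, hv g, smul_comm]

/-- The invariant subspaces of `S` that are associated with its linear characters: the nonzero
spaces among the common eigenspaces `charSpace S χ`. -/
def IsInvariantSubspace (S : Subgroup (E i)) (P : Submodule ℝ (V i)) : Prop :=
  P ≠ ⊥ ∧ ∃ χ : S →* ℝˣ, P = charSpace S χ

/-- All invariant subspaces of the preimages of all `r`-dimensional totally singular subspaces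
of `Ē`. -/
def packing (i r : ℕ) : Set (Submodule ℝ (V i)) :=
  {P | ∃ S : Submodule (ZMod 2) (EBar i),
    IsTotallySingular S ∧ Module.finrank (ZMod 2) S = r ∧ IsInvariantSubspace (preimage S) P}

/-- The Clifford group `L`: the normalizer of `E` in `O(V)`. -/
noncomputable def cliffordGroup (i : ℕ) : Subgroup (O i) := Subgroup.normalizer (E i : Set (O i))

/-- The coordinate space spanned by the `e u` for which the first `r` coordinates of `u`
are zero. -/
noncomputable def coordSpace (i r : ℕ) : Submodule ℝ (V i) :=
  Submodule.span ℝ {x | ∃ u : U i, (∀ j : Fin i, (j : ℕ) < r → u j = 0) ∧ x = e u}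

/-- The orbit of a subspace of `V` under a group of orthogonal transformations. -/
def orbit (G : Subgroup (O i)) (P : Submodule ℝ (V i)) : Set (Submodule ℝ (V i)) :=
  {R | ∃ g ∈ G, R = P.map (g.toLinearEquiv : V i →ₗ[ℝ] V i)}

end Clifford

/-- The Gaussian binomial coefficient
`(2^i - 1)(2^(i-1) - 1)⋯(2^(i-k+1) - 1) / ((2^k - 1)(2^(k-1) - 1)⋯(2 - 1))`, for `k ≤ i`. -/
def gaussBinom (i k : ℕ) : ℚ :=
  (∏ j ∈ Finset.range k, ((2 : ℚ) ^ (i - j) - 1)) /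
    ∏ j ∈ Finset.range k, ((2 : ℚ) ^ (j + 1) - 1)

end GrassmannPacking

/-! Modulo signs, `E` is the phase space of pairs `(a, b)`, and `weyl (a, b) = Y(b) X(a)` is a
projective representation of it with a bilinear factor set. The diagonal of the factor set is `Q`;
its symmetrization decides which operators commute. A member of the packing is a joint eigenspace of
the operators `weyl x`, `x ∈ S`, for signs `(-1)^(c x)`, where `c` trivializes the factor set on the
totally singular `S` (`mem_packing_iff`).

The orthogonal projection onto such a space is the average over `S` of `(-1)^(c x) weyl x`, and
every `weyl x` with `x ≠ 0` has trace zero. So the trace of one average gives the dimension, and the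
trace of a product of two is a multiple of a character sum over `S ⊓ S'`. With `r = i - k` and `m =
dim (S ⊓ S')`, this trace is `0` if the signs disagree somewhere on `S ⊓ S'`, and `2^(k+m-r)`
otherwise. Distinct pairs `(S, c)` thus have trace at most `2^(k-1)` (`trace_average_mul_le`). As
the squared chordal distance is `2^k` minus the trace, this bounds the distance, and it is sharp
when `m = r - 1` and the signs agree.

The same bound shows that the space determines `(S, c)`. Each `S` carries `2^r` choices of `c`, so
it remains to count totally singular subspaces. Ordered bases are built one vector at a time; the
number of possible next vectors comes from a Gauss sum (`card_extensions`).

The normalizer of `E` permutes the operators `weyl x` up to sign, hence permutes the packing.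
Conversely, `S` lies in a maximal totally singular subspace, which has a totally singular complement
dual to it. The two act on a suitable orthonormal basis as the `Y(b)` and `X(a)` act on the `e u`,
up to signs, and the change of basis is the required element of `L` (`exists_map_coordSpace_eq`). -/

namespace GrassmannPacking

open scoped InnerProductSpace

/-! ### Weyl operators and the identification of the phase space with `Ē` -/

section Weyl

variable {i : ℕ}

/-- The phase space `𝔽₂^i × 𝔽₂^i`, whose points label the operators `Y(b) X(a)`. -/
abbrev Phase (i : ℕ) : Type := U i × U i

/-- The factor set of the projective representation `weyl` of the phase space. -/
def factorForm (i : ℕ) : Phase i →ₗ[ZMod 2] Phase i →ₗ[ZMod 2] ZMod 2 :=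
  LinearMap.mk₂ (ZMod 2) (fun x y => y.2 ⬝ᵥ x.1)
    (fun x x' y => by simp [dotProduct_add]) (fun c x y => by simp [dotProduct_smul])
    (fun x y y' => by simp [add_dotProduct]) (fun c x y => by simp [smul_dotProduct])

theorem factorForm_apply (x y : Phase i) : factorForm i x y = y.2 ⬝ᵥ x.1 := rfl

/-- The symplectic form on the phase space. -/
def sympForm (i : ℕ) : Phase i →ₗ[ZMod 2] Phase i →ₗ[ZMod 2] ZMod 2 :=
  factorForm i + (factorForm i).flip

theorem sympForm_apply (x y : Phase i) :
    sympForm i x y = factorForm i x y + factorForm i y x := rfl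

/-- The operator `Y(b) X(a)` attached to the point `(a, b)` of the phase space. -/
noncomputable def weyl (x : Phase i) : O i := Y x.2 * X x.1

theorem weyl_coord (x : Phase i) (v : V i) (u : U i) :
    weyl x v u = sgn (x.2 ⬝ᵥ u) * v (u + x.1) := by
  change Y x.2 (X x.1 v) u = _
  rw [Y_coord, X_coord]

theorem sgn_zero : sgn 0 = 1 := by simp [sgn]

theorem sgn_one : sgn 1 = -1 := by simp [sgn]

theorem sgn_ne_zero (s : ZMod 2) : sgn s ≠ 0 := fun h => by
  have := sgn_mul_self s
  simp [h] at this

theorem weyl_zero (v : V i) : weyl (0 : Phase i) v = v := by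
  ext u
  simp [weyl_coord, sgn_zero]

/-- The sign arises from moving `X(a)` past `Y(b')`. -/
theorem weyl_weyl (x y : Phase i) (v : V i) :
    weyl x (weyl y v) = sgn (factorForm i x y) • weyl (x + y) v := by
  ext u
  rw [PiLp.smul_apply, smul_eq_mul]
  simp only [weyl_coord, factorForm_apply, Prod.snd_add, Prod.fst_add, dotProduct_add,
    add_dotProduct, sgn_add, add_assoc]
  ring

theorem weyl_comm (x y : Phase i) (v : V i) :
    weyl x (weyl y v) = sgn (sympForm i x y) • weyl y (weyl x v) := by
  rw [weyl_weyl, weyl_weyl, smul_smul, sympForm_apply, sgn_add, mul_assoc, sgn_mul_self,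
    mul_one, add_comm x y]

theorem weyl_mem (x : Phase i) : weyl x ∈ E i :=
  (E i).mul_mem (Subgroup.subset_closure (Or.inr ⟨_, rfl⟩))
    (Subgroup.subset_closure (Or.inl ⟨_, rfl⟩))

theorem exists_eq_smul_weyl {g : O i} (hg : g ∈ E i) :
    ∃ (s : ZMod 2) (x : Phase i), ∀ v, g v = sgn s • weyl x v := by
  obtain ⟨s, a, b, h⟩ := E_form hg
  refine ⟨s, (a, b), fun v => ?_⟩
  ext u
  rw [h, PiLp.smul_apply, smul_eq_mul, weyl_coord, sgn_add, mul_assoc]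

/-- A sum of signs over a finite group is nonzero only for the trivial homomorphism. -/
theorem sum_sgn_eq_zero {G : Type*} [AddCommGroup G] [Fintype G] (f : G →+ ZMod 2) {g : G}
    (hg : f g ≠ 0) : ∑ x, sgn (f x) = 0 := by
  have h1 : sgn (f g) = -1 := by simp [sgn, hg]
  have h2 : ∑ x, sgn (f x) = ∑ x, sgn (f (x + g)) :=
    (Equiv.sum_comp (Equiv.addRight g) fun x => sgn (f x)).symm
  simp only [map_add, sgn_add, h1, mul_neg, mul_one, Finset.sum_neg_distrib] at h2
  linarith

theorem exists_dotProduct_ne_zero {a : U i} (ha : a ≠ 0) : ∃ b, a ⬝ᵥ b ≠ 0 := by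
  by_contra! h
  exact ha (dotProduct_eq_zero a h)

/-- `weyl x` as a linear endomorphism. -/
noncomputable def weylLin (x : Phase i) : V i →ₗ[ℝ] V i := (weyl x).toLinearEquiv

theorem weylLin_apply (x : Phase i) (v : V i) : weylLin x v = weyl x v := rfl

theorem trace_weylLin_zero : LinearMap.trace ℝ (V i) (weylLin 0) = 2 ^ i := by
  have : weylLin (0 : Phase i) = LinearMap.id := LinearMap.ext fun v => weyl_zero v
  rw [this, LinearMap.trace_id]
  simp

/-- If `a ≠ 0`, every basis vector is moved and the diagonal vanishes. If `a = 0`, the diagonal is a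
nontrivial character of `U`, whose values sum to zero. -/
theorem trace_weylLin_of_ne {x : Phase i} (hx : x ≠ 0) :
    LinearMap.trace ℝ (V i) (weylLin x) = 0 := by
  rw [LinearMap.trace_eq_sum_inner _ (EuclideanSpace.basisFun (U i) ℝ)]
  by_cases ha : x.1 = 0
  · have hb : x.2 ≠ 0 := fun h => hx (Prod.ext ha h)
    obtain ⟨u, hu⟩ := exists_dotProduct_ne_zero hb
    rw [← sum_sgn_eq_zero (AddMonoidHom.mk' (fun u : U i => x.2 ⬝ᵥ u)
      fun u v => dotProduct_add _ _ _) hu]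
    refine Finset.sum_congr rfl fun u _ => ?_
    simp [weylLin_apply, weyl_coord, ha, EuclideanSpace.inner_single_left]
  · refine Finset.sum_eq_zero fun u _ => ?_
    simp [weylLin_apply, weyl_coord, ha, EuclideanSpace.inner_single_left]

theorem eq_zero_of_weyl_eq_smul {x : Phase i} {c : ℝ} (hc : c ≠ 0)
    (h : ∀ v, weyl x v = c • v) : x = 0 := by
  by_contra hx
  have h1 : weylLin x = c • LinearMap.id := LinearMap.ext h
  have h2 := congrArg (LinearMap.trace ℝ (V i)) h1
  rw [trace_weylLin_of_ne hx, map_smul, LinearMap.trace_id] at h2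
  simp [hc] at h2

theorem add_self_phase (x : Phase i) : x + x = 0 :=
  Prod.ext (funext fun _ => CharTwo.add_self_eq_zero _)
    (funext fun _ => CharTwo.add_self_eq_zero _)

/-- Applying `weyl y`, whose square is a sign, turns `weyl (y + x)` into a nonzero scalar, so its
label is zero by the trace. -/
theorem eq_of_smul_weyl_eq {s t : ZMod 2} {x y : Phase i}
    (h : ∀ v, sgn s • weyl x v = sgn t • weyl y v) : x = y := by
  have h1 : ∀ v, weyl (y + x) v =
      (sgn (factorForm i y x) * sgn s * sgn t * sgn (factorForm i y y)) • v := fun v => by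
    have h2 := congrArg (weyl y) (h v)
    rw [map_smul, map_smul, weyl_weyl, weyl_weyl, add_self_phase, weyl_zero, smul_smul,
      smul_smul] at h2
    have h3 := congrArg (fun w => (sgn (factorForm i y x) * sgn s) • w) h2
    simp only [smul_smul] at h3
    rw [show sgn (factorForm i y x) * sgn s * (sgn s * sgn (factorForm i y x)) =
      (sgn (factorForm i y x) * sgn (factorForm i y x)) * (sgn s * sgn s) by ring,
      sgn_mul_self, sgn_mul_self, one_mul, one_smul] at h3
    rw [h3]
    congr 1
    ring
  have h2 := eq_zero_of_weyl_eq_smul (by simp [sgn_ne_zero]) h1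
  rw [← add_zero x, ← add_self_phase y, ← add_assoc, add_comm x y, h2, zero_add]

/-- The point is that `-I` lies in `E`. This needs `0 < i`: for `i = 0` the group `E` is trivial. -/
theorem exists_smul_weyl_mem (hi : 0 < i) (s : ZMod 2) (x : Phase i) :
    ∃ g ∈ E i, ∀ v, g v = sgn s • weyl x v := by
  have hs : s = 0 ∨ s = 1 := by revert s; decide
  rcases hs with rfl | rfl
  · exact ⟨weyl x, weyl_mem x, fun v => by rw [sgn_zero, one_smul]⟩
  -- `-I` is the commutator of `X(δ)` and `Y(δ)`, because `δ ⬝ᵥ δ = 1`.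
  · let δ : U i := Pi.single ⟨0, hi⟩ 1
    have hδ : sympForm i (δ, 0) (0, δ) = 1 := by
      simp [sympForm_apply, factorForm_apply, δ]
    refine ⟨weyl (δ, 0) * weyl (0, δ) * (weyl (0, δ) * weyl (δ, 0))⁻¹ * weyl x,
      (E i).mul_mem ((E i).mul_mem ((E i).mul_mem (weyl_mem _) (weyl_mem _))
        ((E i).inv_mem ((E i).mul_mem (weyl_mem _) (weyl_mem _)))) (weyl_mem _), fun v => ?_⟩
    change weyl (δ, 0) (weyl (0, δ) ((weyl (0, δ) * weyl (δ, 0))⁻¹ (weyl x v))) = _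
    rw [weyl_comm, hδ]
    congr 1
    exact (weyl (0, δ) * weyl (δ, 0)).apply_symm_apply (weyl x v)

theorem mem_E_of_smul_weyl (hi : 0 < i) {g : O i} {s : ZMod 2} {x : Phase i}
    (h : ∀ v, g v = sgn s • weyl x v) : g ∈ E i := by
  obtain ⟨g', hg', h'⟩ := exists_smul_weyl_mem hi s x
  rwa [show g = g' from LinearIsometryEquiv.ext fun v => by rw [h, h']]

/-- Finiteness makes `g E g⁻¹ ≤ E` sufficient for `g` to normalize `E`. -/
instance : Finite (E i) := by
  have : Function.Surjective
      (fun p : {p : ZMod 2 × Phase i // ∃ g : E i, ∀ v, (g : O i) v = sgn p.1 • weyl p.2 v} =>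
        p.2.choose) := fun g => by
    obtain ⟨s, x, h⟩ := exists_eq_smul_weyl g.2
    refine ⟨⟨(s, x), g, h⟩, ?_⟩
    have h' := (⟨g, h⟩ : ∃ g : E i, ∀ v, (g : O i) v = sgn s • weyl x v).choose_spec
    exact Subtype.ext (LinearIsometryEquiv.ext fun v => by rw [h, h'])
  exact Finite.of_surjective _ this

/-- The image in `Ē` of the operator attached to a point of the phase space. -/
noncomputable def phaseHom (i : ℕ) : Phase i →+ EBar i :=
  AddMonoidHom.mk' (fun x => bar ⟨weyl x, weyl_mem x⟩) fun x y => by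
    rw [← bar_mul]
    refine mk_eq_of_form (s := factorForm i x y) fun v => ?_
    change weyl (x + y) v = sgn _ • weyl x (weyl y v)
    rw [weyl_weyl, smul_smul, sgn_mul_self, one_smul]

theorem bar_eq_phaseHom {g : E i} {s : ZMod 2} {x : Phase i}
    (h : ∀ v, (g : O i) v = sgn s • weyl x v) : bar g = phaseHom i x :=
  mk_eq_of_form (g := g) (g' := ⟨weyl x, weyl_mem x⟩) h

theorem phaseHom_injective : Function.Injective (phaseHom i) := by
  rw [injective_iff_map_eq_zero]
  intro x hx
  have h1 : (QuotientGroup.mk (⟨weyl x, weyl_mem x⟩ : E i) : E i ⧸ Subgroup.center (E i)) = 1 := hx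
  rw [QuotientGroup.eq_one_iff] at h1
  obtain ⟨s, hs⟩ := center_form h1
  exact eq_zero_of_weyl_eq_smul (sgn_ne_zero s) hs

theorem phaseHom_surjective : Function.Surjective (phaseHom i) := by
  intro y
  induction y using QuotientGroup.induction_on with | _ g
  obtain ⟨s, x, h⟩ := exists_eq_smul_weyl g.2
  exact ⟨x, (bar_eq_phaseHom h).symm⟩

/-- The phase space is isomorphic to `Ē`. -/
noncomputable def phaseEquiv (i : ℕ) : Phase i ≃ₗ[ZMod 2] EBar i :=
  LinearEquiv.ofBijective ((phaseHom i).toZModLinearMap 2)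
    ⟨phaseHom_injective, phaseHom_surjective⟩

theorem phaseEquiv_apply (x : Phase i) : phaseEquiv i x = bar ⟨weyl x, weyl_mem x⟩ := rfl

/-- Since `x + x = 0`, the square of `weyl x` is the sign of the factor set at `(x, x)`. -/
theorem Q_phaseEquiv (x : Phase i) : Q (phaseEquiv i x) = factorForm i x x := by
  rw [phaseEquiv_apply, Q_bar]
  have key : ∀ v, (((⟨weyl x, weyl_mem x⟩ : E i) ^ 2 : E i) : O i) v =
      sgn (factorForm i x x) • v := fun v => by
    rw [sq]
    change weyl x (weyl x v) = _
    rw [weyl_weyl, add_self_phase, weyl_zero]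
  have h01 : ∀ t : ZMod 2, t = 0 ∨ t = 1 := by decide
  rcases h01 (factorForm i x x) with h | h
  · rw [if_pos, h]
    apply Subtype.ext
    apply LinearIsometryEquiv.ext
    intro v
    rw [key, h, sgn_zero, one_smul]
    rfl
  · rw [if_neg, h]
    intro h1
    have h2 : ∀ v : V i, v = -v := fun v => by
      have := key v
      rw [h1, h, sgn_one, neg_one_smul] at this
      exact this
    have h3 := h2 (e 0)
    have h4 := congrArg (fun w : V i => w 0) h3
    simp [e] at h4
    linarith

end Weyl

/-! ### Joint eigenspaces, their projections, and the packing in phase-space terms -/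

section FixedSpaces

variable {i : ℕ}

theorem phase_eq_of_add_eq_zero {x y : Phase i} (h : x + y = 0) : x = y := by
  rw [← add_zero x, ← add_self_phase y, ← add_assoc, h, zero_add]

/-- The functions `c` for which `x ↦ (-1)^(c x) weyl x` is a representation of `S`. -/
def IsSplitting (S : Submodule (ZMod 2) (Phase i)) (c : S → ZMod 2) : Prop :=
  ∀ x y : S, c (x + y) = c x + c y + factorForm i x y

/-- The common eigenspace of the operators `weyl x`, `x ∈ S`, for the signs `(-1)^(c x)`. -/
def eigenSpace (S : Submodule (ZMod 2) (Phase i)) (c : S → ZMod 2) : Submodule ℝ (V i) where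
  carrier := {v | ∀ x : S, weyl (x : Phase i) v = sgn (c x) • v}
  add_mem' := fun {v w} hv hw x => by rw [map_add, hv x, hw x, smul_add]
  zero_mem' := fun x => by simp
  smul_mem' := fun r v hv x => by rw [map_smul, hv x, smul_comm]

/-- Compare the eigenvalues of `weyl x ∘ weyl y` and `weyl (x + y)` on a single nonzero vector. -/
theorem isSplitting_of_mem {S : Submodule (ZMod 2) (Phase i)} {c : S → ZMod 2} {v : V i}
    (hv0 : v ≠ 0) (hv : v ∈ eigenSpace S c) : IsSplitting S c := by
  intro x y
  have h1 := weyl_weyl (x : Phase i) y v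
  have h2 := hv (x + y)
  rw [Submodule.coe_add] at h2
  rw [hv y, map_smul, hv x, h2, smul_smul, smul_smul, ← sgn_add, ← sgn_add] at h1
  have h3 := sgn_inj (smul_left_injective ℝ hv0 h1)
  have h4 := CharTwo.add_self_eq_zero (factorForm i x y)
  linear_combination -h3 - h4

namespace IsSplitting

variable {S : Submodule (ZMod 2) (Phase i)} {c : S → ZMod 2} (hc : IsSplitting S c)

include hc

theorem map_zero : c 0 = 0 := by
  have := hc 0 0
  simpa using this

theorem factorForm_self (x : S) : factorForm i x x = 0 := by
  have h := hc x x
  rw [show x + x = 0 from Subtype.ext (add_self_phase (x : Phase i)), hc.map_zero,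
    CharTwo.add_self_eq_zero, zero_add] at h
  exact h.symm

theorem weyl_weyl_self (x : S) (v : V i) : weyl (x : Phase i) (weyl (x : Phase i) v) = v := by
  rw [weyl_weyl, hc.factorForm_self, add_self_phase, weyl_zero, sgn_zero, one_smul]

end IsSplitting

open Classical in
/-- The average of the operators `(-1)^(c x) weyl x`, `x ∈ S`. -/
noncomputable def average (S : Submodule (ZMod 2) (Phase i)) (c : S → ZMod 2) : V i →ₗ[ℝ] V i :=
  (Fintype.card S : ℝ)⁻¹ • ∑ x : S, sgn (c x) • weylLin (x : Phase i)

open Classical in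
theorem average_apply (S : Submodule (ZMod 2) (Phase i)) (c : S → ZMod 2) (v : V i) :
    average S c v = (Fintype.card S : ℝ)⁻¹ • ∑ x : S, sgn (c x) • weyl (x : Phase i) v := by
  simp [average, weylLin_apply]

/-- The splitting makes `x ↦ (-1)^(c x) weyl x` a genuine representation of `S`, so its average
projects onto the invariants: applying the operator of `y` only translates the sum. -/
theorem IsSplitting.isProj_average {S : Submodule (ZMod 2) (Phase i)} {c : S → ZMod 2}
    (hc : IsSplitting S c) : LinearMap.IsProj (eigenSpace S c) (average S c) := by
  classical
  refine ⟨fun v y => ?_, fun v hv => ?_⟩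
  · rw [average_apply, map_smul, smul_comm (sgn (c y)), map_sum]
    congr 1
    rw [Finset.smul_sum,
      ← Equiv.sum_comp (Equiv.addLeft y) fun x : S => sgn (c y) • sgn (c x) • weyl (x : Phase i) v]
    refine Finset.sum_congr rfl fun x _ => ?_
    rw [map_smul, weyl_weyl, Equiv.coe_addLeft, hc y x, Submodule.coe_add, smul_smul, smul_smul,
      sgn_add, sgn_add, ← mul_assoc, ← mul_assoc, sgn_mul_self, one_mul]
  · rw [average_apply]
    have : ∀ x : S, sgn (c x) • weyl (x : Phase i) v = v := fun x => by
      rw [hv x, smul_smul, sgn_mul_self, one_smul]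
    simp only [this, Finset.sum_const, Finset.card_univ]
    rw [← Nat.cast_smul_eq_nsmul ℝ, smul_smul, inv_mul_cancel₀, one_smul]
    exact_mod_cast Fintype.card_ne_zero

/-- For `x ∈ S` the operator `weyl x` is an isometric involution, hence self-adjoint. -/
theorem IsSplitting.isSymmetric_average {S : Submodule (ZMod 2) (Phase i)} {c : S → ZMod 2}
    (hc : IsSplitting S c) : (average S c).IsSymmetric := by
  classical
  intro v w
  rw [average_apply, average_apply, real_inner_smul_left, real_inner_smul_right, sum_inner,
    inner_sum]
  congr 1
  refine Finset.sum_congr rfl fun x _ => ?_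
  rw [real_inner_smul_left, real_inner_smul_right, ← hc.weyl_weyl_self x w,
    LinearIsometryEquiv.inner_map_map, hc.weyl_weyl_self x w]

theorem card_eq_two_pow {M : Type*} [AddCommGroup M] [Module (ZMod 2) M] [Finite M] [Fintype M] :
    Fintype.card M = 2 ^ Module.finrank (ZMod 2) M := by
  rw [Module.card_eq_pow_finrank (K := ZMod 2), ZMod.card]

/-- Only the term `x = 0` has nonzero trace. -/
theorem IsSplitting.trace_average {S : Submodule (ZMod 2) (Phase i)} {c : S → ZMod 2}
    (hc : IsSplitting S c) :
    LinearMap.trace ℝ (V i) (average S c) = 2 ^ i / 2 ^ Module.finrank (ZMod 2) S := by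
  classical
  rw [average, map_smul, map_sum, Finset.sum_eq_single 0]
  · rw [map_smul, hc.map_zero, sgn_zero, one_smul, Submodule.coe_zero, trace_weylLin_zero,
      card_eq_two_pow]
    simp
    field_simp
  · intro x _ hx
    rw [map_smul, trace_weylLin_of_ne (by simpa using hx), smul_zero]
  · simp

theorem IsSplitting.finrank_eigenSpace {S : Submodule (ZMod 2) (Phase i)} {c : S → ZMod 2}
    (hc : IsSplitting S c) :
    (Module.finrank ℝ (eigenSpace S c) : ℝ) = 2 ^ i / 2 ^ Module.finrank (ZMod 2) S := by
  rw [← hc.trace_average, hc.isProj_average.trace]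

theorem IsSplitting.finrank_eigenSpace_of_add {S : Submodule (ZMod 2) (Phase i)} {c : S → ZMod 2}
    (hc : IsSplitting S c) {k : ℕ} (h : Module.finrank (ZMod 2) S + k = i) :
    Module.finrank ℝ (eigenSpace S c) = 2 ^ k := by
  have h1 := hc.finrank_eigenSpace
  rw [eq_div_iff (by positivity), show (2 : ℝ) ^ i = _ from congrArg _ h.symm, pow_add] at h1
  have h2 : (Module.finrank ℝ (eigenSpace S c) : ℝ) = 2 ^ k := by
    have : (2 : ℝ) ^ Module.finrank (ZMod 2) S ≠ 0 := by positivity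
    apply mul_right_cancel₀ this
    rw [h1, mul_comm]
  exact_mod_cast h2

theorem IsSplitting.eigenSpace_ne_bot {S : Submodule (ZMod 2) (Phase i)} {c : S → ZMod 2}
    (hc : IsSplitting S c) : eigenSpace S c ≠ ⊥ := by
  intro h
  have h1 := hc.finrank_eigenSpace
  rw [h, finrank_bot, Nat.cast_zero] at h1
  have : (0 : ℝ) < 2 ^ i / 2 ^ Module.finrank (ZMod 2) S := by positivity
  linarith

/-- The trace of the product of two averages. -/
theorem trace_average_mul {S S' : Submodule (ZMod 2) (Phase i)} {c : S → ZMod 2}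
    {c' : S' → ZMod 2} (hc : IsSplitting S c) :
    LinearMap.trace ℝ (V i) (average S c * average S' c') =
      2 ^ i / (Nat.card S * Nat.card S') *
        ∑ᶠ x : (S ⊓ S' : Submodule (ZMod 2) (Phase i)), sgn (c ⟨x, x.2.1⟩ + c' ⟨x, x.2.2⟩) := by
  classical
  -- The product is a multiple of `weyl (x + y)`, traceless unless `x = y`; this confines the double
  -- sum to the intersection.
  have key : ∀ x : S, ∀ y : S', LinearMap.trace ℝ (V i)
      ((sgn (c x) • weylLin (x : Phase i)) * (sgn (c' y) • weylLin (y : Phase i))) =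
      if (x : Phase i) = y then sgn (c x + c' y) * 2 ^ i else 0 := by
    intro x y
    have h1 : (sgn (c x) • weylLin (x : Phase i)) * (sgn (c' y) • weylLin (y : Phase i)) =
        (sgn (c x + c' y) * sgn (factorForm i x y)) • weylLin ((x : Phase i) + (y : Phase i)) := by
      ext1 v
      change sgn (c x) • weyl (x : Phase i) (sgn (c' y) • weyl (y : Phase i) v) =
        (sgn (c x + c' y) * sgn (factorForm i x y)) • weyl ((x : Phase i) + (y : Phase i)) v
      rw [map_smul, weyl_weyl, smul_smul, smul_smul, sgn_add]
    rw [h1, map_smul]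
    split_ifs with h
    · rw [← h, add_self_phase, hc.factorForm_self, sgn_zero, mul_one, trace_weylLin_zero,
        smul_eq_mul]
    · rw [trace_weylLin_of_ne fun h0 => h (phase_eq_of_add_eq_zero h0), smul_zero]
  rw [average, average, smul_mul_smul_comm, Finset.sum_mul_sum, map_smul, map_sum]
  simp only [map_sum, key]
  rw [finsum_eq_sum_of_fintype, Nat.card_eq_fintype_card, Nat.card_eq_fintype_card, smul_eq_mul,
    div_eq_mul_inv, mul_inv, mul_comm (2 ^ i), mul_assoc _ ((2 : ℝ) ^ i)]
  congr 1
  rw [Finset.mul_sum]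
  symm
  rw [← Finset.sum_product']
  rw [← Finset.sum_filter]
  refine Finset.sum_bij (fun x _ => (⟨x, x.2.1⟩, ⟨x, x.2.2⟩)) (by simp) ?_ ?_ ?_
  · intro x _ y _ h
    exact Subtype.ext (congrArg (fun p => (p.1 : Phase i)) h)
  · rintro ⟨⟨x, hx⟩, ⟨y, hy⟩⟩ h
    simp only [Finset.mem_filter, Finset.mem_product, Finset.mem_univ, true_and] at h
    subst h
    exact ⟨⟨x, hx, hy⟩, by simp⟩
  · intro x _
    rw [mul_comm]

theorem isSymmetric_weylLin {x : Phase i} (hx : factorForm i x x = 0) :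
    (weylLin x).IsSymmetric := by
  intro v w
  have h : ∀ w, weyl x (weyl x w) = w := fun w => by
    rw [weyl_weyl, hx, add_self_phase, weyl_zero, sgn_zero, one_smul]
  rw [weylLin_apply, weylLin_apply, ← LinearIsometryEquiv.inner_map_map (weyl x) v, h]

/-- Polarization: the symplectic form measures the failure of the quadratic form to be additive. -/
theorem sympForm_eq_zero {S : Submodule (ZMod 2) (Phase i)}
    (hS : ∀ x ∈ S, factorForm i x x = 0) {x y : Phase i} (hx : x ∈ S) (hy : y ∈ S) :
    sympForm i x y = 0 := by
  have h := hS _ (S.add_mem hx hy)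
  simp only [map_add, LinearMap.add_apply, hS x hx, hS y hy, zero_add, add_zero] at h
  rw [sympForm_apply, add_comm, h]

theorem eq_sgn_of_mul_self {a : ℝ} (h : a * a = 1) : ∃ s, a = sgn s := by
  rcases mul_self_eq_one_iff.1 h with rfl | rfl
  · exact ⟨0, sgn_zero.symm⟩
  · exact ⟨1, sgn_one.symm⟩

/-- Total singularity gives `weyl x` square `I`, so its eigenvalues are signs. -/
theorem exists_mem_eigenSpace {S : Submodule (ZMod 2) (Phase i)}
    (hS : ∀ x ∈ S, factorForm i x x = 0) {v : V i} (hv0 : v ≠ 0)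
    (hv : ∀ x : S, ∃ r : ℝ, weyl (x : Phase i) v = r • v) : ∃ c, v ∈ eigenSpace S c := by
  have hs : ∀ x : S, ∃ s, weyl (x : Phase i) v = sgn s • v := fun x => by
    obtain ⟨r, hr⟩ := hv x
    have h1 := weyl_weyl (x : Phase i) x v
    rw [hS x x.2, add_self_phase, weyl_zero, sgn_zero, one_smul, hr, map_smul, hr,
      smul_smul] at h1
    obtain ⟨s, rfl⟩ := eq_sgn_of_mul_self (smul_left_injective ℝ hv0 (by simpa using h1))
    exact ⟨s, hr⟩
  choose c hc using hs
  exact ⟨c, hc⟩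

/-- On a totally singular subspace the factor set splits. -/
theorem exists_isSplitting {S : Submodule (ZMod 2) (Phase i)}
    (hS : ∀ x ∈ S, factorForm i x x = 0) : ∃ c, IsSplitting S c := by
  -- Commuting symmetric operators have a joint eigenvector, and the signs read off from any such
  -- vector form a splitting.
  have htop := LinearMap.IsSymmetric.iSup_iInf_eq_top_of_commute
    (T := fun x : S => weylLin (x : Phase i)) (fun x => isSymmetric_weylLin (hS x x.2))
    (fun x y _ => LinearMap.ext fun v => by
      change weyl (x : Phase i) (weyl (y : Phase i) v) = weyl (y : Phase i) (weyl (x : Phase i) v)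
      rw [weyl_comm, sympForm_eq_zero hS x.2 y.2, sgn_zero, one_smul])
  obtain ⟨χ, hχ⟩ : ∃ χ : S → ℝ,
      ⨅ x : S, Module.End.eigenspace (weylLin (x : Phase i)) (χ x) ≠ ⊥ := by
    by_contra! h
    simp only [h, iSup_bot] at htop
    exact bot_ne_top htop
  obtain ⟨v, hv, hv0⟩ := Submodule.exists_mem_ne_zero_of_ne_bot hχ
  obtain ⟨c, hc⟩ := exists_mem_eigenSpace hS hv0 fun x =>
    ⟨χ x, Module.End.mem_eigenspace_iff.1 ((Submodule.mem_iInf _).1 hv x)⟩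
  exact ⟨c, isSplitting_of_mem hv0 hc⟩

theorem IsSplitting.add_additive {S : Submodule (ZMod 2) (Phase i)} {c c' : S → ZMod 2}
    (hc : IsSplitting S c) (hc' : IsSplitting S c') (x y : S) :
    c (x + y) + c' (x + y) = (c x + c' x) + (c y + c' y) := by
  rw [hc, hc']
  have := CharTwo.add_self_eq_zero (factorForm i x y)
  linear_combination this

theorem mem_preimage_map {S : Submodule (ZMod 2) (Phase i)} {g : E i} :
    g ∈ preimage (S.map (phaseEquiv i).toLinearMap) ↔
      ∃ s, ∃ x ∈ S, ∀ v, (g : O i) v = sgn s • weyl x v := by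
  constructor
  · rintro ⟨x, hx, hxg⟩
    obtain ⟨s, y, h⟩ := exists_eq_smul_weyl g.2
    have : x = y := (phaseEquiv i).injective (hxg.trans (bar_eq_phaseHom h))
    exact ⟨s, y, this ▸ hx, h⟩
  · rintro ⟨s, x, hx, h⟩
    exact ⟨x, hx, (bar_eq_phaseHom h).symm⟩

/-- One common nonzero vector forces `χ` and `c` to encode the same eigenvalues on every element of
the preimage. -/
theorem charSpace_eq_eigenSpace {S : Submodule (ZMod 2) (Phase i)} {c : S → ZMod 2}
    {χ : preimage (S.map (phaseEquiv i).toLinearMap) →* ℝˣ} {v : V i} (hv0 : v ≠ 0)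
    (hv : v ∈ eigenSpace S c) (hv' : v ∈ charSpace _ χ) : charSpace _ χ = eigenSpace S c := by
  ext w
  constructor
  · intro hw x
    let g : preimage (S.map (phaseEquiv i).toLinearMap) :=
      ⟨⟨weyl (x : Phase i), weyl_mem _⟩, x, x.2, rfl⟩
    have h1 : (χ g : ℝ) = sgn (c x) :=
      smul_left_injective ℝ hv0 ((hv' g).symm.trans (hv x))
    rw [← h1]
    exact hw g
  · intro hw g
    obtain ⟨s, x, hx, h⟩ := mem_preimage_map.1 g.2
    have h1 : (χ g : ℝ) = sgn s * sgn (c ⟨x, hx⟩) := by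
      apply smul_left_injective ℝ hv0
      beta_reduce
      rw [← hv' g, h, hv ⟨x, hx⟩, smul_smul]
    rw [h, hw ⟨x, hx⟩, h1, smul_smul]

/-- This replaces subgroups of `E` and their characters by pairs `(S, c)` in the phase space. A
nonzero vector of the space mediates: its eigenvalues define `c` from `χ`, and `χ` from `c`. -/
theorem mem_packing_iff {r : ℕ} {P : Submodule ℝ (V i)} :
    P ∈ packing i r ↔ ∃ (S : Submodule (ZMod 2) (Phase i)) (c : S → ZMod 2),
      Module.finrank (ZMod 2) S = r ∧ IsSplitting S c ∧ P = eigenSpace S c := by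
  constructor
  · rintro ⟨T, hT, hTr, hP0, χ, rfl⟩
    obtain ⟨S, rfl⟩ : ∃ S : Submodule (ZMod 2) (Phase i),
        T = S.map (phaseEquiv i).toLinearMap :=
      ⟨T.comap (phaseEquiv i).toLinearMap,
        (Submodule.map_comap_eq_of_surjective (phaseEquiv i).surjective T).symm⟩
    obtain ⟨v, hv, hv0⟩ := Submodule.exists_mem_ne_zero_of_ne_bot hP0
    have hS : ∀ x ∈ S, factorForm i x x = 0 := fun x hx => by
      rw [← Q_phaseEquiv]
      exact hT _ ⟨x, hx, rfl⟩
    obtain ⟨c, hc⟩ := exists_mem_eigenSpace hS hv0 fun x =>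
      ⟨_, hv ⟨⟨weyl (x : Phase i), weyl_mem _⟩, x, x.2, rfl⟩⟩
    exact ⟨S, c, (LinearEquiv.finrank_map_eq (phaseEquiv i) S).symm.trans hTr,
      isSplitting_of_mem hv0 hc, charSpace_eq_eigenSpace hv0 hc hv⟩
  · rintro ⟨S, c, hSr, hc, rfl⟩
    refine ⟨S.map (phaseEquiv i).toLinearMap, ?_, ?_, hc.eigenSpace_ne_bot, ?_⟩
    · rintro _ ⟨x, hx, rfl⟩
      exact (Q_phaseEquiv x).trans (hc.factorForm_self ⟨x, hx⟩)
    · rw [← hSr]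
      exact LinearEquiv.finrank_map_eq (phaseEquiv i) S
    · obtain ⟨v, hv, hv0⟩ := Submodule.exists_mem_ne_zero_of_ne_bot hc.eigenSpace_ne_bot
      have hex : ∀ g : preimage (S.map (phaseEquiv i).toLinearMap),
          ∃ a : ℝ, ((g : E i) : O i) v = a • v := fun g => by
        obtain ⟨s, x, hx, h⟩ := mem_preimage_map.1 g.2
        exact ⟨sgn s * sgn (c ⟨x, hx⟩), by rw [h, hv ⟨x, hx⟩, smul_smul]⟩
      choose f hf using hex
      let χ : preimage (S.map (phaseEquiv i).toLinearMap) →* ℝ :=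
        { toFun := f
          map_one' := by
            apply smul_left_injective ℝ hv0
            beta_reduce
            rw [← hf, one_smul]
            rfl
          map_mul' := fun g g' => by
            apply smul_left_injective ℝ hv0
            beta_reduce
            rw [← hf, mul_comm, mul_smul, ← hf g, ← map_smul, ← hf g']
            rfl }
      have hv' : v ∈ charSpace _ χ.toHomUnits := hf
      exact ⟨χ.toHomUnits, (charSpace_eq_eigenSpace hv0 hv hv').symm⟩

end FixedSpaces

/-! ### Chordal distance through traces of products of projections -/

section Distance

theorem starProjection_eq_sum {W : Type*} [NormedAddCommGroup W] [InnerProductSpace ℝ W]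
    [FiniteDimensional ℝ W] {n : ℕ} {P : Submodule ℝ W} (hP : Module.finrank ℝ P = n)
    {u : Fin n → W} (hu : Orthonormal ℝ u) (huP : ∀ j, u j ∈ P) :
    P.starProjection = ∑ j, InnerProductSpace.rankOne ℝ (u j) (u j) := by
  let u' : Fin n → P := fun j => ⟨u j, huP j⟩
  have hu' : Orthonormal ℝ u' := ⟨fun j => hu.1 j, fun j l hjl => hu.2 hjl⟩
  have hspan := hu'.linearIndependent.span_eq_top_of_card_eq_finrank' (by simp [hP])
  rw [(OrthonormalBasis.mk hu' hspan.ge).starProjection_eq_sum_rankOne]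
  simp [u']

theorem trace_starProjection_mul {W : Type*} [NormedAddCommGroup W] [InnerProductSpace ℝ W]
    [FiniteDimensional ℝ W] {n : ℕ} {P R : Submodule ℝ W} (hP : Module.finrank ℝ P = n)
    (hR : Module.finrank ℝ R = n) {u v : Fin n → W} (hu : Orthonormal ℝ u)
    (hv : Orthonormal ℝ v) (huP : ∀ j, u j ∈ P) (hvR : ∀ j, v j ∈ R) :
    LinearMap.trace ℝ W ((P.starProjection : W →ₗ[ℝ] W) * (R.starProjection : W →ₗ[ℝ] W)) =
      ∑ j, ∑ l, ⟪u l, v j⟫_ℝ ^ 2 := by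
  have h1 : (P.starProjection : W →ₗ[ℝ] W) * (R.starProjection : W →ₗ[ℝ] W) =
      ∑ j, (InnerProductSpace.rankOne ℝ (P.starProjection (v j)) (v j) : W →ₗ[ℝ] W) := by
    ext x
    simp [starProjection_eq_sum hR hv hvR]
  rw [h1, map_sum]
  refine Finset.sum_congr rfl fun j _ => ?_
  rw [InnerProductSpace.trace_rankOne, starProjection_eq_sum hP hu huP]
  simp [inner_sum, inner_smul_right, sq, real_inner_comm]

/-- The sum of the squared cosines of the principal angles is the trace of the product of the two
projections. -/
theorem chordalDist_eq_sqrt_trace {W : Type*} [NormedAddCommGroup W] [InnerProductSpace ℝ W]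
    [FiniteDimensional ℝ W] {n : ℕ} (P R : Gr W n) :
    chordalDist P R = Real.sqrt (n - LinearMap.trace ℝ W
      ((P.1.starProjection : W →ₗ[ℝ] W) * (R.1.starProjection : W →ₗ[ℝ] W))) := by
  have h := principalVectors_spec P R
  unfold chordalDist principalAngle
  rw [h.sum_sin_sq, trace_starProjection_mul P.2 R.2 h.orthonormal.1 h.orthonormal.2
    (fun j => (h j).1.1) (fun j => (h j).1.2.1)]

variable {i : ℕ} {S S' : Submodule (ZMod 2) (Phase i)} {c : S → ZMod 2} {c' : S' → ZMod 2}

theorem IsSplitting.starProjection_eigenSpace (hc : IsSplitting S c) :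
    ((eigenSpace S c).starProjection : V i →ₗ[ℝ] V i) = average S c := by
  ext1 v
  refine Submodule.eq_starProjection_of_mem_of_inner_eq_zero (hc.isProj_average.map_mem v)
    fun w hw => ?_
  rw [inner_sub_left, hc.isSymmetric_average, hc.isProj_average.map_id w hw, sub_self]

/-- On the intersection the factor sets of `c` and `c'` cancel, so `c + c'` is additive and the sum
runs over a nontrivial character. -/
theorem sum_sgn_inf_of_ne (hc : IsSplitting S c) (hc' : IsSplitting S' c')
    (h : ∃ x, ∃ h : x ∈ S, ∃ h' : x ∈ S', c ⟨x, h⟩ ≠ c' ⟨x, h'⟩) :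
    ∑ᶠ x : (S ⊓ S' : Submodule (ZMod 2) (Phase i)),
      sgn (c ⟨x, x.2.1⟩ + c' ⟨x, x.2.2⟩) = 0 := by
  classical
  obtain ⟨x, hx, hx', hne⟩ := h
  rw [finsum_eq_sum_of_fintype]
  refine sum_sgn_eq_zero (AddMonoidHom.mk' (fun x : (S ⊓ S' : Submodule (ZMod 2) (Phase i)) =>
    c ⟨x, x.2.1⟩ + c' ⟨x, x.2.2⟩) fun x y => ?_) (g := ⟨x, hx, hx'⟩) ?_
  · have h1 := hc ⟨x, x.2.1⟩ ⟨y, y.2.1⟩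
    have h2 := hc' ⟨x, x.2.2⟩ ⟨y, y.2.2⟩
    have := CharTwo.add_self_eq_zero (factorForm i (x : Phase i) (y : Phase i))
    dsimp only at h1 h2
    change c (⟨x, x.2.1⟩ + ⟨y, y.2.1⟩) + c' (⟨x, x.2.2⟩ + ⟨y, y.2.2⟩) = _
    rw [h1, h2]
    linear_combination this
  · intro h
    apply hne
    change c ⟨x, hx⟩ + c' ⟨x, hx'⟩ = 0 at h
    exact CharTwo.add_eq_zero.1 h

theorem sum_sgn_inf_of_eq (h : ∀ x, ∀ h : x ∈ S, ∀ h' : x ∈ S', c ⟨x, h⟩ = c' ⟨x, h'⟩) :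
    ∑ᶠ x : (S ⊓ S' : Submodule (ZMod 2) (Phase i)),
      sgn (c ⟨x, x.2.1⟩ + c' ⟨x, x.2.2⟩) =
        2 ^ Module.finrank (ZMod 2) (S ⊓ S' : Submodule (ZMod 2) (Phase i)) := by
  classical
  rw [finsum_eq_sum_of_fintype]
  simp only [h _ _ (Submodule.mem_inf.1 (Subtype.prop _)).2, CharTwo.add_self_eq_zero, sgn_zero,
    Finset.sum_const, Finset.card_univ, nsmul_eq_mul, mul_one, card_eq_two_pow]
  simp

theorem natCard_eq_two_pow {M : Type*} [AddCommGroup M] [Module (ZMod 2) M] [Finite M] :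
    (Nat.card M : ℝ) = 2 ^ Module.finrank (ZMod 2) M := by
  rw [Module.natCard_eq_pow_finrank (K := ZMod 2)]
  simp

theorem trace_average_mul_of_eq {k r m : ℕ} (hk : r + k = i)
    (hr : Module.finrank (ZMod 2) S = r) (hr' : Module.finrank (ZMod 2) S' = r)
    (hm : Module.finrank (ZMod 2) (S ⊓ S' : Submodule (ZMod 2) (Phase i)) = m)
    (hc : IsSplitting S c) (h : ∀ x, ∀ h : x ∈ S, ∀ h' : x ∈ S', c ⟨x, h⟩ = c' ⟨x, h'⟩) :
    LinearMap.trace ℝ (V i) (average S c * average S' c') = 2 ^ k * 2 ^ m / 2 ^ r := by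
  rw [trace_average_mul hc, sum_sgn_inf_of_eq h, natCard_eq_two_pow, natCard_eq_two_pow, hr, hr',
    hm, show (2 : ℝ) ^ i = _ from congrArg _ hk.symm, pow_add]
  field_simp

/-- If the signs disagree on the intersection, the trace is zero. If they agree, then `S ≠ S'`, so
the intersection has dimension at most `r - 1`. -/
theorem trace_average_mul_le {k r : ℕ} (hk : r + k = i)
    (hr : Module.finrank (ZMod 2) S = r) (hr' : Module.finrank (ZMod 2) S' = r)
    (hc : IsSplitting S c) (hc' : IsSplitting S' c')
    (hne : (⟨S, c⟩ : Σ S : Submodule (ZMod 2) (Phase i), S → ZMod 2) ≠ ⟨S', c'⟩) :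
    LinearMap.trace ℝ (V i) (average S c * average S' c') ≤ 2 ^ k / 2 := by
  by_cases h : ∃ x, ∃ h : x ∈ S, ∃ h' : x ∈ S', c ⟨x, h⟩ ≠ c' ⟨x, h'⟩
  · rw [trace_average_mul hc, sum_sgn_inf_of_ne hc hc' h, mul_zero]
    positivity
  · push Not at h
    have hSS : S ≠ S' := by
      rintro rfl
      exact hne (Sigma.ext rfl (heq_of_eq (funext fun x => h x x.2 x.2)))
    have hlt : Module.finrank (ZMod 2) (S ⊓ S' : Submodule (ZMod 2) (Phase i)) < r := by
      rw [← hr]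
      apply Submodule.finrank_lt_finrank_of_lt
      refine lt_of_le_of_ne inf_le_left fun h1 => hSS ?_
      exact Submodule.eq_of_le_of_finrank_eq (inf_eq_left.1 h1) (hr.trans hr'.symm)
    rw [trace_average_mul_of_eq hk hr hr' rfl hc h, div_le_div_iff₀ (by positivity) (by positivity),
      mul_assoc, ← pow_succ]
    gcongr
    · norm_num
    · exact hlt

theorem IsSplitting.chordalDist_eq {n : ℕ} (hc : IsSplitting S c) (hc' : IsSplitting S' c')
    {P R : Gr (V i) n} (hP : P.1 = eigenSpace S c) (hR : R.1 = eigenSpace S' c') :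
    chordalDist P R =
      Real.sqrt (n - LinearMap.trace ℝ (V i) (average S c * average S' c')) := by
  rw [chordalDist_eq_sqrt_trace, ← hc.starProjection_eigenSpace, ← hc'.starProjection_eigenSpace,
    hP, hR]

/-- The space determines the subspace of the phase space and the signs. -/
theorem eigenSpace_injective (hc : IsSplitting S c) (hc' : IsSplitting S' c')
    (hr : Module.finrank (ZMod 2) S = Module.finrank (ZMod 2) S') {k : ℕ}
    (hk : Module.finrank (ZMod 2) S + k = i) (h : eigenSpace S c = eigenSpace S' c') :
    (⟨S, c⟩ : Σ S : Submodule (ZMod 2) (Phase i), S → ZMod 2) = ⟨S', c'⟩ := by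
  -- Distinct pairs would have trace at most `2^k / 2`, whereas equal projections give `2^k`.
  by_contra hne
  have h1 := trace_average_mul_le hk rfl hr.symm hc hc' hne
  have h2 : average S' c' = average S c := by
    rw [← hc.starProjection_eigenSpace, ← hc'.starProjection_eigenSpace, h]
  rw [h2, trace_average_mul_of_eq hk rfl rfl (by rw [inf_idem]) hc fun _ _ _ => rfl] at h1
  rw [mul_div_assoc, div_self (by positivity), mul_one] at h1
  have : (0 : ℝ) < 2 ^ k := by positivity
  linarith

theorem sqrt_two_pow_half (k : ℕ) :
    Real.sqrt ((2 : ℝ) ^ k - 2 ^ k / 2) = (2 : ℝ) ^ (((k : ℝ) - 1) / 2) := by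
  have h : (2 : ℝ) ^ k - 2 ^ k / 2 = (2 : ℝ) ^ ((k : ℝ) - 1) := by
    rw [Real.rpow_sub_one two_ne_zero, Real.rpow_natCast]
    ring
  rw [h, Real.sqrt_eq_rpow, ← Real.rpow_mul zero_le_two]
  congr 1
  ring

end Distance

/-! ### Phase-space subspaces given by supports, and the coordinate space -/

section Coordinates

variable {i : ℕ}

/-- The points `(a, b)` of the phase space such that `a` is supported on `J` and `b` on `K`. -/
def supportedOn (J K : Finset (Fin i)) : Submodule (ZMod 2) (Phase i) where
  carrier := {x | (∀ j ∉ J, x.1 j = 0) ∧ ∀ j ∉ K, x.2 j = 0}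
  add_mem' := fun {x y} hx hy =>
    ⟨fun j hj => by simp [hx.1 j hj, hy.1 j hj], fun j hj => by simp [hx.2 j hj, hy.2 j hj]⟩
  zero_mem' := by simp
  smul_mem' := fun t x hx =>
    ⟨fun j hj => by simp [hx.1 j hj], fun j hj => by simp [hx.2 j hj]⟩

theorem mem_supportedOn {J K : Finset (Fin i)} {x : Phase i} :
    x ∈ supportedOn J K ↔ (∀ j ∉ J, x.1 j = 0) ∧ ∀ j ∉ K, x.2 j = 0 := Iff.rfl

theorem supportedOn_inf (J K J' K' : Finset (Fin i)) :
    supportedOn J K ⊓ supportedOn J' K' = supportedOn (J ∩ J') (K ∩ K') := by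
  ext x
  simp only [Submodule.mem_inf, mem_supportedOn, Finset.mem_inter, not_and_or]
  aesop

theorem finrank_supportedOn (J K : Finset (Fin i)) :
    Module.finrank (ZMod 2) (supportedOn J K) = J.card + K.card := by
  have hcard : Nat.card (supportedOn J K) = 2 ^ (J.card + K.card) := by
    have hF : ∀ J : Finset (Fin i), (Fintype.piFinset fun j : Fin i =>
        if j ∈ J then (Finset.univ : Finset (ZMod 2)) else {0}).card = 2 ^ J.card := fun J => by
      rw [Fintype.card_piFinset]
      simp [apply_ite Finset.card, ZMod.card]
    rw [pow_add, ← hF J, ← hF K, ← Finset.card_product]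
    refine Nat.subtype_card _ fun x => ?_
    have h : ∀ (J : Finset (Fin i)) (a : U i), (∀ j, a j ∈ if j ∈ J then
        (Finset.univ : Finset (ZMod 2)) else {0}) ↔ ∀ j ∉ J, a j = 0 := fun J a => by
      refine forall_congr' fun j => ?_
      split_ifs with hj <;> simp [hj]
    rw [Finset.mem_product, Fintype.mem_piFinset, Fintype.mem_piFinset, h, h]
    rfl
  rw [Module.natCard_eq_pow_finrank (K := ZMod 2), Nat.card_zmod] at hcard
  exact Nat.pow_right_injective le_rfl hcard

theorem isSplitting_supportedOn {J K : Finset (Fin i)} (h : Disjoint J K) :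
    IsSplitting (supportedOn J K) 0 := by
  intro x y
  have : factorForm i x y = 0 := by
    rw [factorForm_apply]
    refine Finset.sum_eq_zero fun j _ => ?_
    by_cases hj : j ∈ J
    · rw [y.2.2 j (Finset.disjoint_left.1 h hj), zero_mul]
    · rw [x.2.1 j hj, mul_zero]
  simp [this]

/-- The first `r` indices. -/
def firstIndices (i r : ℕ) : Finset (Fin i) := Finset.univ.filter fun j => (j : ℕ) < r

theorem mem_firstIndices {r : ℕ} {j : Fin i} : j ∈ firstIndices i r ↔ (j : ℕ) < r := by
  simp [firstIndices]

theorem card_firstIndices {r : ℕ} (hr : r ≤ i) : (firstIndices i r).card = r := by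
  rw [firstIndices, Fin.card_filter_val_lt, min_eq_right hr]

theorem weyl_e (x : Phase i) (u : U i) :
    weyl x (e u) = sgn (x.2 ⬝ᵥ (u + x.1)) • e (u + x.1) := by
  change Y x.2 (X x.1 (e u)) = _
  rw [X_e, Y_e]

theorem coordSpace_eq_eigenSpace (r : ℕ) :
    coordSpace i r = eigenSpace (supportedOn ∅ (firstIndices i r)) 0 := by
  apply le_antisymm
  · rw [coordSpace, Submodule.span_le]
    rintro _ ⟨u, hu, rfl⟩ x
    rw [weyl_e, show (x : Phase i).1 = 0 from funext fun j => x.2.1 j (by simp), add_zero]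
    congr 2
    refine Finset.sum_eq_zero fun j _ => ?_
    by_cases hj : j ∈ firstIndices i r
    · rw [hu j (mem_firstIndices.1 hj), mul_zero]
    · rw [x.2.2 j hj, zero_mul]
  · intro v hv
    rw [show v = ∑ u, v u • e u from
      ((EuclideanSpace.basisFun (U i) ℝ).sum_repr v).symm.trans (by simp [e])]
    refine Submodule.sum_mem _ fun u _ => ?_
    by_cases hu : ∀ j : Fin i, (j : ℕ) < r → u j = 0
    · exact Submodule.smul_mem _ _ (Submodule.subset_span ⟨u, hu, rfl⟩)
    · push Not at hu
      obtain ⟨j, hj, hj0⟩ := hu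
      -- This point acts on the coordinate `u` by `-1`, as `u j ≠ 0`, while `v` is fixed; hence `v u
      -- = 0`.
      have h1 := hv ⟨(0, Pi.single j 1), by simp, fun l hl => by
        refine Pi.single_eq_of_ne ?_ _
        rintro rfl
        exact hl (mem_firstIndices.2 hj)⟩
      have h2 := congrArg (fun w : V i => w u) h1
      simp only [weyl_coord, single_one_dotProduct, add_zero, Pi.zero_apply, sgn_zero,
        one_smul] at h2
      rw [sgn, if_neg hj0] at h2
      rw [show v u = 0 by linarith, zero_smul]
      exact Submodule.zero_mem _

end Coordinates

/-! ### Counting totally singular subspaces and the members of the packing -/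

section Counting

variable {i : ℕ}

theorem factorForm_add_self (x y : Phase i) :
    factorForm i (x + y) (x + y) = factorForm i x x + factorForm i y y + sympForm i x y := by
  simp only [map_add, LinearMap.add_apply, sympForm_apply]
  ring

theorem exists_sympForm_ne_zero {x : Phase i} (hx : x ≠ 0) : ∃ y, sympForm i y x ≠ 0 := by
  by_cases ha : x.1 = 0
  · obtain ⟨b, hb⟩ := exists_dotProduct_ne_zero (a := x.2) fun h => hx (Prod.ext ha h)
    exact ⟨(b, 0), by simpa [sympForm_apply, factorForm_apply] using hb⟩
  · obtain ⟨b, hb⟩ := exists_dotProduct_ne_zero ha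
    exact ⟨(0, b), by simpa [sympForm_apply, factorForm_apply, dotProduct_comm] using hb⟩

theorem sum_sgn_linear {M : Type*} [AddCommGroup M] [Module (ZMod 2) M] [Fintype M]
    (f : M →ₗ[ZMod 2] ZMod 2) : ∑ x, sgn (f x) = if f = 0 then (Fintype.card M : ℝ) else 0 := by
  split_ifs with h
  · simp [h, sgn_zero]
  · obtain ⟨x, hx⟩ : ∃ x, f x ≠ 0 := by
      by_contra! h'
      exact h (LinearMap.ext h')
    exact sum_sgn_eq_zero f.toAddMonoidHom hx

/-- The Gauss sum of the quadratic form. -/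
theorem sum_sgn_factorForm : ∑ x : Phase i, sgn (factorForm i x x) = 2 ^ i := by
  rw [Fintype.sum_prod_type, Finset.sum_eq_single 0]
  · simp [factorForm_apply, sgn_zero, Fintype.card_pi, ZMod.card]
  · intro a _ ha
    obtain ⟨b, hb⟩ := exists_dotProduct_ne_zero ha
    exact sum_sgn_eq_zero (AddMonoidHom.mk' (fun b : U i => b ⬝ᵥ a)
      fun u v => add_dotProduct _ _ _) (g := b) (by rwa [dotProduct_comm] at hb)
  · simp

/-- For singular `s` the linear twist is absorbed by the translation `x ↦ x + s`. -/
theorem sum_sgn_factorForm_add_sympForm {s : Phase i} (hs : factorForm i s s = 0) :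
    ∑ x : Phase i, sgn (factorForm i x x) * sgn (sympForm i x s) = 2 ^ i := by
  rw [← sum_sgn_factorForm,
    ← Equiv.sum_comp (Equiv.addRight s) fun x => sgn (factorForm i x x)]
  refine Finset.sum_congr rfl fun x _ => ?_
  rw [Equiv.coe_addRight, factorForm_add_self, hs, add_zero, sgn_add]

/-- The orthogonal complement with respect to the symplectic form. -/
def perp (S : Submodule (ZMod 2) (Phase i)) : Set (Phase i) := {x | ∀ s ∈ S, sympForm i x s = 0}

open Classical in
theorem sum_sgn_sympForm (S : Submodule (ZMod 2) (Phase i)) (x : Phase i) :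
    ∑ s : S, sgn (sympForm i x s) = if x ∈ perp S then (Fintype.card S : ℝ) else 0 := by
  have h := sum_sgn_linear ((sympForm i x).comp S.subtype)
  rw [show (∑ s : S, sgn (sympForm i x s)) = _ from h]
  congr 1
  rw [eq_iff_iff, LinearMap.ext_iff]
  exact ⟨fun h s hs => h ⟨s, hs⟩, fun h s => h s s.2⟩

-- Sum the twisted Gauss sums over `s ∈ S` in both orders; by orthogonality, summing over `s` first
-- leaves only `x ∈ perp S`.
open Classical in
theorem sum_perp_sgn_factorForm {S : Submodule (ZMod 2) (Phase i)}
    (hS : ∀ x ∈ S, factorForm i x x = 0) :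
    ∑ x : Phase i with x ∈ perp S, sgn (factorForm i x x) = 2 ^ i := by
  have h1 : ∑ s : S, ∑ x : Phase i, sgn (factorForm i x x) * sgn (sympForm i x s) =
      Fintype.card S * 2 ^ i := by
    simp [sum_sgn_factorForm_add_sympForm (hS _ (Subtype.prop _))]
  rw [Finset.sum_comm] at h1
  simp only [← Finset.mul_sum, sum_sgn_sympForm, mul_ite, mul_zero] at h1
  rw [← Finset.sum_filter, ← Finset.sum_mul, mul_comm] at h1
  exact mul_left_cancel₀ (by exact_mod_cast Fintype.card_ne_zero) h1

-- The same double count without the quadratic form, using nondegeneracy to kill every `s ≠ 0`.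
open Classical in
theorem card_perp (S : Submodule (ZMod 2) (Phase i)) :
    (Fintype.card S : ℝ) * ∑ x : Phase i with x ∈ perp S, (1 : ℝ) = 2 ^ (2 * i) := by
  have h1 : ∑ s : S, ∑ x : Phase i, sgn (sympForm i x s) = 2 ^ (2 * i) := by
    rw [Finset.sum_eq_single 0]
    · simp [sgn_zero, ZMod.card, two_mul, pow_add]
    · intro s _ hs
      obtain ⟨x, hx⟩ := exists_sympForm_ne_zero (x := (s : Phase i)) (by simpa using hs)
      exact sum_sgn_eq_zero ((sympForm i).flip (s : Phase i)).toAddMonoidHom hx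
    · simp
  rw [Finset.sum_comm] at h1
  simp only [sum_sgn_sympForm] at h1
  rw [← h1, Finset.mul_sum, ← Finset.sum_filter]
  simp

/-- The points that span, together with `S`, a totally singular subspace larger than `S`. -/
def extensions (S : Submodule (ZMod 2) (Phase i)) : Set (Phase i) :=
  {x | x ∉ S ∧ factorForm i x x = 0 ∧ x ∈ perp S}

/-- The indicator of singularity is `(1 + sgn q) / 2`, where `q` is the quadratic form. Summed over
`perp S` it gives `(2^(2i-m) + 2^i) / 2` singular vectors, of which the `2^m` in `S` are discarded.
-/
theorem card_extensions {S : Submodule (ZMod 2) (Phase i)}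
    (hS : ∀ x ∈ S, factorForm i x x = 0) {m n : ℕ} (hm : Module.finrank (ZMod 2) S = m)
    (hn : m + (n + 1) = i) :
    Nat.card (extensions S) = 2 ^ m * ((2 ^ (n + 1) - 1) * (2 ^ n + 1)) := by
  classical
  have h1 := sum_perp_sgn_factorForm hS
  have h2 := card_perp S
  have hSm : Fintype.card S = 2 ^ m := by rw [card_eq_two_pow, hm]
  have h3 : ∑ x : Phase i with x ∈ perp S, (1 + sgn (factorForm i x x)) =
      2 * (Nat.card (extensions S) + Fintype.card S) := by
    have h4 : ∀ t : ZMod 2, 1 + sgn t = if t = 0 then 2 else 0 := fun t => by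
      rw [sgn]
      split_ifs <;> norm_num
    have h5 : Nat.card (extensions S) + Fintype.card S =
        (Finset.univ.filter fun x : Phase i => x ∈ perp S ∧ factorForm i x x = 0).card := by
      have hE : Nat.card (extensions S) =
          (Finset.univ.filter fun x : Phase i => x ∈ extensions S).card :=
        Nat.subtype_card _ fun x => by simp
      have hF : Fintype.card S = (Finset.univ.filter fun x : Phase i => x ∈ S).card :=
        Fintype.card_subtype _
      rw [hE, hF, ← Finset.card_union_of_disjoint]
      · congr 1
        ext x
        simp only [Finset.mem_union, Finset.mem_filter, Finset.mem_univ, true_and]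
        constructor
        · rintro (h | h)
          · exact ⟨h.2.2, h.2.1⟩
          · exact ⟨fun s hs => sympForm_eq_zero hS h hs, hS x h⟩
        · rintro ⟨h, h'⟩
          by_cases hx : x ∈ S
          · exact Or.inr hx
          · exact Or.inl ⟨hx, h', h⟩
      · rw [Finset.disjoint_filter]
        exact fun x _ h => h.1
    simp only [h4]
    rw [← Finset.sum_filter, Finset.filter_filter, Finset.sum_const, ← h5, nsmul_eq_mul]
    push_cast
    ring
  rw [Finset.sum_add_distrib, h1] at h3
  have h4 : (2 : ℝ) ^ m * (2 * (Nat.card (extensions S) + Fintype.card S) - 2 ^ i) =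
      2 ^ (2 * i) := by
    rw [← h3, ← h2, hSm]
    push_cast
    ring
  have h5 : (Nat.card (extensions S) : ℝ) = 2 ^ m * ((2 ^ (n + 1) - 1) * (2 ^ n + 1)) := by
    rw [hSm, show (2 : ℝ) ^ (2 * i) = (2 ^ i) ^ 2 by ring,
      show (2 : ℝ) ^ i = _ from congrArg _ hn.symm] at h4
    have hpos : (2 : ℝ) * 2 ^ m ≠ 0 := by positivity
    apply mul_left_cancel₀ hpos
    push_cast at h4
    rw [pow_add, pow_succ] at h4
    rw [pow_succ]
    linear_combination h4
  have h6 : (1 : ℕ) ≤ 2 ^ (n + 1) := Nat.one_le_two_pow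
  rw [← Nat.cast_inj (R := ℝ), h5]
  push_cast [h6]
  ring

/-- A basis of a totally singular subspace. -/
def IsFrame {m : ℕ} (x : Fin m → Phase i) : Prop :=
  LinearIndependent (ZMod 2) x ∧
    ∀ y ∈ Submodule.span (ZMod 2) (Set.range x), factorForm i y y = 0

theorem isFrame_cons {m : ℕ} {x : Fin m → Phase i} {y : Phase i} :
    IsFrame (Fin.cons y x : Fin (m + 1) → Phase i) ↔
      IsFrame x ∧ y ∈ extensions (Submodule.span (ZMod 2) (Set.range x)) := by
  unfold IsFrame
  rw [linearIndependent_finCons, Fin.range_cons]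
  constructor
  · rintro ⟨⟨h1, h2⟩, h3⟩
    have hle := Submodule.span_mono (R := ZMod 2) (Set.subset_insert y (Set.range x))
    have hy := Submodule.subset_span (R := ZMod 2) (Set.mem_insert y (Set.range x))
    exact ⟨⟨h1, fun z hz => h3 z (hle hz)⟩, h2, h3 y hy, fun z hz =>
      sympForm_eq_zero h3 hy (hle hz)⟩
  · rintro ⟨⟨h1, h2⟩, h3, h4, h5⟩
    refine ⟨⟨h1, h3⟩, fun z hz => ?_⟩
    obtain ⟨a, w, hw, rfl⟩ := Submodule.mem_span_insert.1 hz
    rw [factorForm_add_self, h2 w hw]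
    simp [h4, h5 w hw]

theorem finrank_span_isFrame {m : ℕ} {x : Fin m → Phase i} (hx : IsFrame x) :
    Module.finrank (ZMod 2) (Submodule.span (ZMod 2) (Set.range x)) = m := by
  rw [finrank_span_eq_card hx.1, Fintype.card_fin]

/-- A frame with one more vector is a frame together with an extension of it. -/
def frameSuccEquiv (i m : ℕ) : {x : Fin (m + 1) → Phase i // IsFrame x} ≃
    Σ x : {x : Fin m → Phase i // IsFrame x},
      extensions (Submodule.span (ZMod 2) (Set.range (x : Fin m → Phase i))) where
  toFun x := ⟨⟨Fin.tail x.1, (isFrame_cons.1 ((Fin.cons_self_tail x.1).symm ▸ x.2)).1⟩,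
    ⟨x.1 0, (isFrame_cons.1 ((Fin.cons_self_tail x.1).symm ▸ x.2)).2⟩⟩
  invFun p := ⟨Fin.cons p.2.1 p.1.1, isFrame_cons.2 ⟨p.1.2, p.2.2⟩⟩
  left_inv x := Subtype.ext (Fin.cons_self_tail x.1)
  right_inv _ := rfl

theorem card_isFrame {m n : ℕ} (h : m + n = i) :
    Nat.card {x : Fin m → Phase i // IsFrame x} =
      ∏ j ∈ Finset.range m, 2 ^ j * ((2 ^ (i - j) - 1) * (2 ^ (i - j - 1) + 1)) := by
  classical
  induction m generalizing n with
  | zero =>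
    rw [Finset.prod_range_zero, Nat.card_eq_one_iff_unique]
    refine ⟨inferInstance, ⟨⟨Fin.elim0, ?_, ?_⟩⟩⟩
    · exact linearIndependent_empty_type
    · intro y hy
      rw [Set.range_eq_empty, Submodule.span_empty, Submodule.mem_bot] at hy
      simp [hy]
  | succ m ih =>
    have : Fintype {x : Fin m → Phase i // IsFrame x} := Fintype.ofFinite _
    rw [Nat.card_congr (frameSuccEquiv i m), Nat.card_sigma, Finset.prod_range_succ,
      ← ih (n := n + 1) (by omega)]
    have hx : ∀ x : {x : Fin m → Phase i // IsFrame x},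
        Nat.card (extensions (Submodule.span (ZMod 2) (Set.range (x : Fin m → Phase i)))) =
          2 ^ m * ((2 ^ (i - m) - 1) * (2 ^ (i - m - 1) + 1)) := fun x => by
      rw [card_extensions x.2.2 (finrank_span_isFrame x.2) (show m + (n + 1) = i by omega),
        show i - m = n + 1 by omega, Nat.add_sub_cancel]
    simp only [hx, Finset.sum_const, Finset.card_univ, smul_eq_mul, Nat.card_eq_fintype_card]

/-- The totally singular subspaces of dimension `r` of the phase space. -/
abbrev SingularSubspace (i r : ℕ) : Type :=
  {S : Submodule (ZMod 2) (Phase i) //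
    Module.finrank (ZMod 2) S = r ∧ ∀ x ∈ S, factorForm i x x = 0}

/-- Send a frame to its span: the fibre over `S` is the set of ordered bases of `S`. -/
theorem card_singularSubspace_mul (i r : ℕ) :
    Nat.card (SingularSubspace i r) * ∏ j ∈ Finset.range r, (2 ^ r - 2 ^ j) =
      Nat.card {x : Fin r → Phase i // IsFrame x} := by
  classical
  let f : {x : Fin r → Phase i // IsFrame x} → SingularSubspace i r := fun x =>
    ⟨Submodule.span (ZMod 2) (Set.range x.1), finrank_span_isFrame x.2, x.2.2⟩
  have hfib : ∀ S : SingularSubspace i r,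
      Nat.card {x // f x = S} = ∏ j ∈ Finset.range r, (2 ^ r - 2 ^ j) := by
    rintro ⟨S, hS, hS'⟩
    have h1 := card_linearIndependent (K := ZMod 2) (V := S) (k := r) hS.ge
    rw [hS, ZMod.card, Fin.prod_univ_eq_prod_range (fun j => 2 ^ r - 2 ^ j)] at h1
    rw [← h1]
    have hspan : ∀ y : Fin r → S, LinearIndependent (ZMod 2) y →
        Submodule.span (ZMod 2) (Set.range fun j => (y j : Phase i)) = S := fun y hy => by
      have hy' : LinearIndependent (ZMod 2) fun j => (y j : Phase i) :=
        hy.map' S.subtype S.ker_subtype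
      apply Submodule.eq_of_le_of_finrank_eq
      · rw [Submodule.span_le]
        rintro _ ⟨j, rfl⟩
        exact (y j).2
      · rw [finrank_span_eq_card hy', Fintype.card_fin, hS]
    symm
    refine Nat.card_eq_of_bijective (fun y => ⟨⟨fun j => (y.1 j : Phase i),
      y.2.map' S.subtype S.ker_subtype, ?_⟩, ?_⟩) ⟨?_, ?_⟩
    · rw [hspan y.1 y.2]
      exact hS'
    · exact Subtype.ext (hspan y.1 y.2)
    · intro y y' h
      have h2 := congrArg (fun z => z.1.1) h
      exact Subtype.ext (funext fun j => Subtype.ext (congrFun h2 j))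
    · rintro ⟨⟨x, hx⟩, hxS⟩
      have hmem : ∀ j, x j ∈ S := fun j => by
        rw [← show Submodule.span (ZMod 2) (Set.range x) = S from congrArg Subtype.val hxS]
        exact Submodule.subset_span ⟨j, rfl⟩
      exact ⟨⟨fun j => ⟨x j, hmem j⟩, LinearIndependent.of_comp S.subtype hx.1⟩, rfl⟩
  have : Fintype (SingularSubspace i r) := Fintype.ofFinite _
  rw [← Nat.card_congr (Equiv.sigmaFiberEquiv f), Nat.card_sigma]
  simp only [hfib, Finset.sum_const, Finset.card_univ, smul_eq_mul, Nat.card_eq_fintype_card]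

/-- The splittings form a torsor under the dual space of `S`. -/
theorem card_isSplitting {S : Submodule (ZMod 2) (Phase i)}
    (hS : ∀ x ∈ S, factorForm i x x = 0) :
    Nat.card {c : S → ZMod 2 // IsSplitting S c} = 2 ^ Module.finrank (ZMod 2) S := by
  obtain ⟨c, hc⟩ := exists_isSplitting hS
  have h1 : Nat.card (Module.Dual (ZMod 2) S) = 2 ^ Module.finrank (ZMod 2) S := by
    rw [Module.natCard_eq_pow_finrank (K := ZMod 2), Subspace.dual_finrank_eq, Nat.card_zmod]
  rw [← h1]
  symm
  refine Nat.card_eq_of_bijective (fun f => ⟨fun x => c x + f x, fun x y => ?_⟩) ⟨?_, ?_⟩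
  · beta_reduce
    rw [hc, map_add]
    ring
  · intro f f' h
    exact LinearMap.ext fun x => add_left_cancel (congrFun (congrArg Subtype.val h) x)
  · rintro ⟨c', hc'⟩
    refine ⟨(AddMonoidHom.mk' (fun x => c x + c' x) (hc.add_additive hc')).toZModLinearMap 2, ?_⟩
    refine Subtype.ext (funext fun x => ?_)
    change c x + (c x + c' x) = c' x
    rw [← add_assoc, CharTwo.add_self_eq_zero, zero_add]

theorem finite_packing (i r : ℕ) : (packing i r).Finite := by
  refine (Set.finite_range fun p : Σ S : Submodule (ZMod 2) (Phase i), S → ZMod 2 =>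
    eigenSpace p.1 p.2).subset fun P hP => ?_
  obtain ⟨S, c, -, -, rfl⟩ := mem_packing_iff.1 hP
  exact ⟨⟨S, c⟩, rfl⟩

theorem ncard_packing {r k : ℕ} (h : r + k = i) :
    (packing i r).ncard = 2 ^ r * Nat.card (SingularSubspace i r) := by
  classical
  have : Fintype (SingularSubspace i r) := Fintype.ofFinite _
  have h1 : Nat.card (Σ S : SingularSubspace i r, {c : S.1 → ZMod 2 // IsSplitting S.1 c}) =
      2 ^ r * Nat.card (SingularSubspace i r) := by
    rw [Nat.card_sigma]
    have : ∀ S : SingularSubspace i r,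
        Nat.card {c : S.1 → ZMod 2 // IsSplitting S.1 c} = 2 ^ r := fun S => by
      rw [card_isSplitting S.2.2, S.2.1]
    simp only [this, Finset.sum_const, Finset.card_univ, smul_eq_mul, Nat.card_eq_fintype_card]
    rw [mul_comm]
  rw [← h1, ← Nat.card_coe_set_eq]
  symm
  refine Nat.card_eq_of_bijective (fun p => ⟨eigenSpace p.1.1 p.2.1,
    mem_packing_iff.2 ⟨_, _, p.1.2.1, p.2.2, rfl⟩⟩) ⟨?_, ?_⟩
  · rintro ⟨⟨S, hS, hS1⟩, c, hc⟩ ⟨⟨S', hS', hS1'⟩, c', hc'⟩ hp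
    have h2 := eigenSpace_injective hc hc' (hS.trans hS'.symm) (k := k) (hS ▸ h)
      (congrArg Subtype.val hp)
    obtain ⟨rfl, h3⟩ := Sigma.mk.inj_iff.1 h2
    obtain rfl := eq_of_heq h3
    rfl
  · rintro ⟨P, hP⟩
    obtain ⟨S, c, hS, hc, rfl⟩ := mem_packing_iff.1 hP
    exact ⟨⟨⟨S, hS, fun x hx => hc.factorForm_self ⟨x, hx⟩⟩, c, hc⟩, rfl⟩

theorem prod_two_pow_sub_one_ne_zero (n : ℕ) :
    ∏ j ∈ Finset.range n, ((2 : ℚ) ^ (j + 1) - 1) ≠ 0 := by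
  refine Finset.prod_ne_zero_iff.2 fun j _ => ?_
  have : (1 : ℚ) < 2 ^ (j + 1) := one_lt_pow₀ one_lt_two (by omega)
  linarith

theorem prod_two_pow_sub_one_mul {r k : ℕ} (h : r + k = i) :
    (∏ j ∈ Finset.range r, ((2 : ℚ) ^ (i - j) - 1)) *
      ∏ j ∈ Finset.range k, ((2 : ℚ) ^ (j + 1) - 1) =
        ∏ j ∈ Finset.range i, ((2 : ℚ) ^ (j + 1) - 1) := by
  have hrefl : ∀ n, ∏ j ∈ Finset.range n, ((2 : ℚ) ^ (j + 1) - 1) =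
      ∏ j ∈ Finset.range n, ((2 : ℚ) ^ (n - j) - 1) := fun n => by
    rw [← Finset.prod_range_reflect]
    refine Finset.prod_congr rfl fun j hj => ?_
    have := Finset.mem_range.1 hj
    rw [show n - 1 - j + 1 = n - j by omega]
  rw [hrefl, hrefl, ← h, Finset.prod_range_add]
  congr 1
  refine Finset.prod_congr rfl fun j _ => ?_
  rw [show r + k - (r + j) = k - j by omega]

/-- The symmetry between `k` and `r = i - k`: the frame count produces the top `r` factors, while
the definition uses the top `k`. -/
theorem gaussBinom_mul {r k : ℕ} (h : r + k = i) :
    gaussBinom i k * ∏ j ∈ Finset.range r, ((2 : ℚ) ^ (j + 1) - 1) =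
      ∏ j ∈ Finset.range r, ((2 : ℚ) ^ (i - j) - 1) := by
  have h1 := prod_two_pow_sub_one_mul h
  have h2 := prod_two_pow_sub_one_mul ((add_comm k r).trans h)
  have h3 := prod_two_pow_sub_one_ne_zero k
  rw [gaussBinom, div_mul_eq_mul_div, div_eq_iff h3, h1, h2]

theorem card_singularSubspace {r k : ℕ} (h : r + k = i) (hr : 0 < r) :
    (Nat.card (SingularSubspace i r) : ℚ) =
      gaussBinom i k * ∏ j ∈ Finset.Icc k (i - 1), ((2 : ℚ) ^ j + 1) := by
  have h1 := card_singularSubspace_mul i r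
  rw [card_isFrame h] at h1
  have h2 := congrArg (Nat.cast : ℕ → ℚ) h1
  have h3 : ((∏ j ∈ Finset.range r, (2 ^ r - 2 ^ j) : ℕ) : ℚ) =
      (∏ j ∈ Finset.range r, (2 : ℚ) ^ j) * ∏ j ∈ Finset.range r, ((2 : ℚ) ^ (j + 1) - 1) := by
    rw [← Finset.prod_range_reflect (fun j => (2 : ℚ) ^ (j + 1) - 1), ← Finset.prod_mul_distrib,
      Nat.cast_prod]
    refine Finset.prod_congr rfl fun j hj => ?_
    have hj' := Finset.mem_range.1 hj
    rw [Nat.cast_sub (Nat.pow_le_pow_right (by norm_num) hj'.le), mul_sub, ← pow_add,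
      show j + (r - 1 - j + 1) = r by omega]
    push_cast
    ring
  have h4 : ((∏ j ∈ Finset.range r, 2 ^ j * ((2 ^ (i - j) - 1) * (2 ^ (i - j - 1) + 1)) : ℕ) : ℚ) =
      (∏ j ∈ Finset.range r, (2 : ℚ) ^ j) * ((∏ j ∈ Finset.range r, ((2 : ℚ) ^ (i - j) - 1)) *
        ∏ j ∈ Finset.Icc k (i - 1), ((2 : ℚ) ^ j + 1)) := by
    have h5 : ∏ j ∈ Finset.Icc k (i - 1), ((2 : ℚ) ^ j + 1) =
        ∏ j ∈ Finset.range r, ((2 : ℚ) ^ (i - j - 1) + 1) := by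
      -- Here `0 < r` matters: it gives `0 < i`, so that `i - 1` is not truncated.
      rw [show Finset.Icc k (i - 1) = Finset.Ico k i by ext; simp; omega,
        Finset.prod_Ico_eq_prod_range, show i - k = r by omega, ← Finset.prod_range_reflect]
      refine Finset.prod_congr rfl fun j hj => ?_
      have hj' := Finset.mem_range.1 hj
      rw [show k + (r - 1 - j) = i - j - 1 by omega]
    rw [h5, ← Finset.prod_mul_distrib, ← Finset.prod_mul_distrib, Nat.cast_prod]
    refine Finset.prod_congr rfl fun j _ => ?_
    push_cast [Nat.one_le_two_pow]
    ring
  rw [Nat.cast_mul, h3, h4, ← gaussBinom_mul h] at h2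
  have h6 : ∏ j ∈ Finset.range r, (2 : ℚ) ^ j ≠ 0 := Finset.prod_ne_zero_iff.2 fun j _ => by
    positivity
  apply mul_right_cancel₀ (mul_ne_zero h6 (prod_two_pow_sub_one_ne_zero r))
  rw [h2]
  ring

end Counting

/-! ### The packing as an orbit of the Clifford group -/

section CliffordOrbit

variable {i : ℕ}

theorem exists_conj_weyl {g : O i} (hg : g ∈ cliffordGroup i) (x : Phase i) :
    ∃ (s : ZMod 2) (y : Phase i), ∀ v, g (weyl x v) = sgn s • weyl y (g v) := by
  obtain ⟨s, y, h⟩ := exists_eq_smul_weyl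
    ((Subgroup.mem_normalizer_iff.1 hg (weyl x)).1 (weyl_mem x))
  refine ⟨s, y, fun v => ?_⟩
  rw [← h]
  change _ = g (weyl x (g⁻¹ (g v)))
  rw [show g⁻¹ (g v) = v from g.symm_apply_apply v]

/-- Elements of the Clifford group permute the spaces of the packing. -/
theorem map_mem_packing {g : O i} (hg : g ∈ cliffordGroup i) {r k : ℕ} (hk : r + k = i)
    {P : Submodule ℝ (V i)} (hP : P ∈ packing i r) :
    P.map (g.toLinearEquiv : V i →ₗ[ℝ] V i) ∈ packing i r := by
  obtain ⟨S, c, hS, hc, rfl⟩ := mem_packing_iff.1 hP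
  choose s σ h using exists_conj_weyl hg
  -- Conjugate `weyl x ∘ weyl y` by `g` in two ways; the label of an operator is unique, even up to
  -- sign.
  have hadd : ∀ x y, σ (x + y) = σ x + σ y := fun x y => by
    apply eq_of_smul_weyl_eq (s := factorForm i x y + s (x + y))
      (t := s x + s y + factorForm i (σ x) (σ y))
    intro v
    obtain ⟨w, rfl⟩ := g.surjective v
    rw [sgn_add, mul_smul, ← h, ← map_smul, ← weyl_weyl, h, h, map_smul, smul_smul, weyl_weyl,
      smul_smul, sgn_add, sgn_add]
  have hinj : Function.Injective σ := by
    intro x y hxy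
    apply eq_of_smul_weyl_eq (s := s x) (t := s y)
    intro v
    apply g.injective
    rw [map_smul, map_smul, h, h, hxy, smul_smul, smul_smul, sgn_mul_self, sgn_mul_self]
  let σ' : Phase i →ₗ[ZMod 2] Phase i := (AddMonoidHom.mk' σ hadd).toZModLinearMap 2
  have hfin : Module.finrank (ZMod 2) (S.map σ') = r :=
    (LinearEquiv.finrank_eq (Submodule.equivMapOfInjective σ' hinj S)).symm.trans hS
  obtain ⟨v, hv, hv0⟩ := Submodule.exists_mem_ne_zero_of_ne_bot hc.eigenSpace_ne_bot
  have hσ : ∀ x : S, ∀ v ∈ eigenSpace S c,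
      weyl (σ x) (g v) = (sgn (s x) * sgn (c x)) • g v := fun x v hv => by
    have h1 := h x v
    rw [hv x, map_smul] at h1
    rw [mul_smul, h1, smul_smul, sgn_mul_self, one_smul]
  have hc' : ∀ y : S.map σ', ∃ t, ∀ v ∈ eigenSpace S c,
      weyl (y : Phase i) (g v) = sgn t • g v := by
    rintro ⟨_, x, hx, rfl⟩
    exact ⟨s x + c ⟨x, hx⟩, fun v hv => (hσ ⟨x, hx⟩ v hv).trans (by rw [sgn_add])⟩
  choose c' hc' using hc'
  have hcc : IsSplitting (S.map σ') c' := isSplitting_of_mem (v := g v)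
    (by simpa using hv0) fun y => hc' y v hv
  refine mem_packing_iff.2 ⟨S.map σ', c', hfin, hcc, ?_⟩
  apply Submodule.eq_of_le_of_finrank_eq
  · rintro _ ⟨v, hv, rfl⟩ y
    exact hc' y v hv
  · rw [hcc.finrank_eigenSpace_of_add (hfin.symm ▸ hk), ← hc.finrank_eigenSpace_of_add (hS.symm ▸ hk)]
    exact LinearEquiv.finrank_map_eq g.toLinearEquiv _

/-- Every frame extends to a frame of a maximal totally singular subspace. -/
theorem IsFrame.exists_extend {r : ℕ} {x : Fin r → Phase i} (hx : IsFrame x) {n : ℕ}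
    (hrn : r ≤ n) (hn : n ≤ i) :
    ∃ y : Fin n → Phase i, IsFrame y ∧
      ∀ j, ∃ l : Fin n, (n - r : ℕ) ≤ (l : ℕ) ∧ y l = x j := by
  induction n, hrn using Nat.le_induction with
  | base => exact ⟨x, hx, fun j => ⟨j, by simp, rfl⟩⟩
  | succ n hrn ih =>
    obtain ⟨y, hy, hyx⟩ := ih (by omega)
    have h1 := card_extensions hy.2 (finrank_span_isFrame hy) (n := i - n - 1) (by omega)
    have h2 : 0 < Nat.card (extensions (Submodule.span (ZMod 2) (Set.range y))) := by
      rw [h1]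
      have : 1 < 2 ^ (i - n - 1 + 1) := Nat.one_lt_two_pow (by omega)
      have : 0 < 2 ^ (i - n - 1 + 1) - 1 := by omega
      positivity
    obtain ⟨⟨z, hz⟩⟩ := (Nat.card_pos_iff.1 h2).1
    -- New vectors enter at the front, so the original ones occupy the last `r` positions.
    refine ⟨Fin.cons z y, isFrame_cons.2 ⟨hy, hz⟩, fun j => ?_⟩
    obtain ⟨l, hl, hlx⟩ := hyx j
    exact ⟨l.succ, by rw [Fin.val_succ]; omega, by rw [Fin.cons_succ, hlx]⟩

theorem IsFrame.comp_equiv {n : ℕ} {y : Fin n → Phase i} (hy : IsFrame y) (τ : Fin n ≃ Fin n) :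
    IsFrame (y ∘ τ) :=
  ⟨hy.1.comp τ τ.injective, by rw [τ.surjective.range_comp]; exact hy.2⟩

/-- A totally singular subspace is the image of a coordinate space under a parametrization of a
maximal totally singular subspace. -/
theorem exists_lagrangian {S : Submodule (ZMod 2) (Phase i)} {r : ℕ}
    (hS : ∀ x ∈ S, factorForm i x x = 0) (hr : Module.finrank (ZMod 2) S = r) (hri : r ≤ i) :
    ∃ φ : U i →ₗ[ZMod 2] Phase i, Function.Injective φ ∧ (∀ u, factorForm i (φ u) (φ u) = 0) ∧
      S ≤ Submodule.map φ (Submodule.span (ZMod 2)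
        {u | ∃ j : Fin i, (j : ℕ) < r ∧ u = Pi.single j 1}) := by
  let b := Module.finBasisOfFinrankEq (ZMod 2) S hr
  have hspan : Submodule.span (ZMod 2) (Set.range fun j => (b j : Phase i)) = S := by
    have h1 := congrArg (Submodule.map S.subtype) b.span_eq
    rw [Submodule.map_span, ← Set.range_comp, Submodule.map_subtype_top] at h1
    exact h1
  have hb : IsFrame fun j => (b j : Phase i) :=
    ⟨b.linearIndependent.map' S.subtype S.ker_subtype, by rw [hspan]; exact hS⟩
  obtain ⟨y, hy, hyb⟩ := hb.exists_extend hri le_rfl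
  -- Reversal brings the original vectors to the first `r` positions, matching `coordSpace`.
  have hy' := hy.comp_equiv Fin.revPerm
  refine ⟨Fintype.linearCombination (ZMod 2) (y ∘ Fin.revPerm),
    hy'.1.fintypeLinearCombination_injective, fun u => hy'.2 _ ?_, ?_⟩
  · rw [← Fintype.range_linearCombination]
    exact ⟨u, rfl⟩
  · rw [← hspan, Submodule.span_le]
    rintro _ ⟨j, rfl⟩
    obtain ⟨l, hl, hlb⟩ := hyb j
    refine ⟨Pi.single (Fin.rev l) 1, Submodule.subset_span ⟨Fin.rev l, ?_, rfl⟩, ?_⟩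
    · rw [Fin.val_rev]
      have := l.2
      omega
    · rw [Fintype.linearCombination_apply_single]
      simp [hlb]

theorem sympForm_comm (x y : Phase i) : sympForm i x y = sympForm i y x := by
  rw [sympForm_apply, add_comm, ← sympForm_apply]

/-- A maximal totally singular subspace has a totally singular complement in duality with it. -/
theorem exists_dual_lagrangian {φ : U i →ₗ[ZMod 2] Phase i} (hφ : Function.Injective φ)
    (hφq : ∀ u, factorForm i (φ u) (φ u) = 0) :
    ∃ ψ : U i →ₗ[ZMod 2] Phase i, (∀ a, factorForm i (ψ a) (ψ a) = 0) ∧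
      ∀ b a, sympForm i (φ b) (ψ a) = b ⬝ᵥ a := by
  have hinj : Function.Injective (sympForm i) := by
    rw [injective_iff_map_eq_zero]
    intro x hx
    by_contra hx0
    obtain ⟨y, hy⟩ := exists_sympForm_ne_zero hx0
    apply hy
    rw [sympForm_comm, hx, LinearMap.zero_apply]
  have hsurj : Function.Surjective (sympForm i) :=
    (LinearMap.injective_iff_surjective_of_finrank_eq_finrank
      (Subspace.dual_finrank_eq (K := ZMod 2) (V := Phase i)).symm).1 hinj
  -- Every functional on `U` is, through `φ`, the pairing with some point; `R` chooses this point
  -- linearly.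
  obtain ⟨R, hR⟩ := LinearMap.exists_rightInverse_of_surjective
    (φ.dualMap ∘ₗ sympForm i)
    (LinearMap.range_eq_top.2 ((LinearMap.dualMap_surjective_of_injective hφ).comp hsurj))
  let dot : U i →ₗ[ZMod 2] Module.Dual (ZMod 2) (U i) :=
    LinearMap.mk₂ (ZMod 2) (fun a b => b ⬝ᵥ a)
      (fun x x' y => by simp [dotProduct_add]) (fun c x y => by simp [dotProduct_smul])
      (fun x y y' => by simp [add_dotProduct]) (fun c x y => by simp [smul_dotProduct])
  let ψ₀ : U i →ₗ[ZMod 2] Phase i := R ∘ₗ dot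
  have hψ₀ : ∀ b a, sympForm i (φ b) (ψ₀ a) = b ⬝ᵥ a := fun b a => by
    have h1 := LinearMap.congr_fun (LinearMap.congr_fun hR (dot a)) b
    rw [sympForm_comm]
    exact h1
  have hφφ : ∀ u w, sympForm i (φ u) (φ w) = 0 := fun u w =>
    sympForm_eq_zero (S := LinearMap.range φ) (by rintro _ ⟨u, rfl⟩; exact hφq u) ⟨u, rfl⟩ ⟨w, rfl⟩
  -- The dual family `ψ₀` need not be singular. `T` is chosen with `T a ⬝ᵥ a` equal to the quadratic
  -- form at `ψ₀ a`; adding `φ (T a)` cancels this value and keeps the pairing, since the range of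
  -- `φ` is isotropic.
  let T : U i →ₗ[ZMod 2] U i :=
    LinearMap.pi fun j => (factorForm i).flip (ψ₀ (Pi.single j 1)) ∘ₗ ψ₀
  have hT : ∀ a, T a ⬝ᵥ a = factorForm i (ψ₀ a) (ψ₀ a) := fun a => by
    have h1 : a = ∑ j, a j • Pi.single j (1 : ZMod 2) := by
      ext l
      simp [Finset.sum_apply, Pi.single_apply]
    have h2 : ψ₀ a = ∑ j, a j • ψ₀ (Pi.single j 1) := by
      conv_lhs => rw [h1]
      simp
    conv_rhs => arg 2; rw [h2]
    rw [map_sum]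
    refine Finset.sum_congr rfl fun j _ => ?_
    rw [map_smul, smul_eq_mul, mul_comm]
    rfl
  refine ⟨ψ₀ + φ ∘ₗ T, fun a => ?_, fun b a => ?_⟩
  · change factorForm i (ψ₀ a + φ (T a)) (ψ₀ a + φ (T a)) = 0
    rw [factorForm_add_self, hφq, add_zero, sympForm_comm, hψ₀, hT, CharTwo.add_self_eq_zero]
  · rw [LinearMap.add_apply, map_add, hψ₀, LinearMap.comp_apply, hφφ, add_zero]

/-- Take any splitting of `S'`; on `S` it differs from `c` by a linear functional, which extends to
`S'`. -/
theorem IsSplitting.exists_extend {S S' : Submodule (ZMod 2) (Phase i)} {c : S → ZMod 2}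
    (hc : IsSplitting S c) (h : S ≤ S') (hS' : ∀ x ∈ S', factorForm i x x = 0) :
    ∃ c', IsSplitting S' c' ∧ ∀ x : S, c' ⟨x, h x.2⟩ = c x := by
  obtain ⟨c₀, hc₀⟩ := exists_isSplitting hS'
  have hc₁ : IsSplitting S fun x => c₀ ⟨x, h x.2⟩ := fun x y => hc₀ ⟨x, h x.2⟩ ⟨y, h y.2⟩
  let l : S →ₗ[ZMod 2] ZMod 2 :=
    (AddMonoidHom.mk' (fun x => c x + c₀ ⟨x, h x.2⟩) (hc.add_additive hc₁)).toZModLinearMap 2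
  obtain ⟨l', hl'⟩ := LinearMap.exists_extend l
  refine ⟨fun x => c₀ x + l' x, fun x y => ?_, fun x => ?_⟩
  · beta_reduce
    rw [hc₀, Submodule.coe_add, map_add]
    ring
  · have h1 : l' x = c x + c₀ ⟨x, h x.2⟩ := LinearMap.congr_fun hl' x
    beta_reduce
    rw [h1, add_left_comm, CharTwo.add_self_eq_zero, add_zero]

/-- Conjugation needs checking only on the generators, and since `E` is finite one inclusion
suffices. -/
theorem mem_cliffordGroup_of_conj (hi : 0 < i) {g : O i}
    (hX : ∀ a, ∃ s x, ∀ v, g (X a v) = sgn s • weyl x (g v))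
    (hY : ∀ b, ∃ s x, ∀ v, g (Y b v) = sgn s • weyl x (g v)) : g ∈ cliffordGroup i := by
  have hmem : ∀ h : O i, (∃ s x, ∀ v, g (h v) = sgn s • weyl x (g v)) → g * h * g⁻¹ ∈ E i := by
    rintro h ⟨s, x, hsx⟩
    refine mem_E_of_smul_weyl hi (s := s) (x := x) fun v => ?_
    change g (h (g⁻¹ v)) = _
    rw [hsx, show g (g⁻¹ v) = v from g.apply_symm_apply v]
  have : Finite (E i : Set (O i)) := inferInstanceAs (Finite (E i))
  refine Subgroup.mem_normalizer_fintype fun h hh => ?_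
  have hle : E i ≤ (E i).comap (MulAut.conj g).toMonoidHom := by
    refine (Subgroup.closure_le _).2 ?_
    rintro _ (⟨a, rfl⟩ | ⟨b, rfl⟩)
    · exact hmem _ (hX a)
    · exact hmem _ (hY b)
  exact hle hh

/-- The Clifford group maps the coordinate space to every space of the packing. -/
theorem exists_map_coordSpace_eq (hi : 0 < i) {S : Submodule (ZMod 2) (Phase i)}
    {c : S → ZMod 2} (hc : IsSplitting S c) {r k : ℕ} (hr : Module.finrank (ZMod 2) S = r)
    (hk : r + k = i) :
    ∃ g ∈ cliffordGroup i,
      eigenSpace S c = (coordSpace i r).map (g.toLinearEquiv : V i →ₗ[ℝ] V i) := by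
  obtain ⟨φ, hφ, hφq, hφS⟩ := exists_lagrangian (fun x hx => hc.factorForm_self ⟨x, hx⟩) hr
    (by omega)
  obtain ⟨ψ, hψq, hφψ⟩ := exists_dual_lagrangian hφ hφq
  have hSφ : S ≤ LinearMap.range φ := hφS.trans LinearMap.map_le_range
  obtain ⟨c', hc', hcc'⟩ := hc.exists_extend hSφ (by rintro _ ⟨u, rfl⟩; exact hφq u)
  obtain ⟨d, hd⟩ := exists_isSplitting (S := LinearMap.range ψ)
    (by rintro _ ⟨u, rfl⟩; exact hψq u)
  obtain ⟨w, hw, hw0⟩ := Submodule.exists_mem_ne_zero_of_ne_bot hc'.eigenSpace_ne_bot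
  let ψ' : U i → LinearMap.range ψ := fun u => ⟨ψ u, u, rfl⟩
  let φ' : U i → LinearMap.range φ := fun u => ⟨φ u, u, rfl⟩
  let f₀ : V i := (‖w‖⁻¹ : ℝ) • w
  have hf₀ : f₀ ∈ eigenSpace _ c' := Submodule.smul_mem _ _ hw
  have hf₀n : ‖f₀‖ = 1 := norm_smul_inv_norm hw0
  -- `f₀` plays the role of `e 0`. The signs `d` make the operators of `ψ` a genuine representation
  -- of `U`, which translates the family `f` as `X` translates the `e u`.
  let f : U i → V i := fun u => sgn (d (ψ' u)) • weyl (ψ u) f₀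
  have hψf : ∀ a u, weyl (ψ a) (f u) = sgn (d (ψ' a)) • f (u + a) := fun a u => by
    have h1 : d (ψ' (u + a)) = d (ψ' a) + d (ψ' u) + factorForm i (ψ a) (ψ u) := by
      rw [← show d (ψ' a + ψ' u) = _ from hd _ _]
      congr 1
      exact Subtype.ext (by simp [ψ', add_comm])
    rw [map_smul, weyl_weyl, smul_smul, smul_smul, h1, ← map_add, add_comm a u, sgn_add, sgn_add,
      ← mul_assoc, ← mul_assoc, sgn_mul_self, one_mul]
  have hφf : ∀ b u, weyl (φ b) (f u) = (sgn (c' (φ' b)) * sgn (b ⬝ᵥ u)) • f u := fun b u => by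
    rw [map_smul, weyl_comm, hφψ, hf₀ (φ' b), map_smul, smul_smul, smul_smul, smul_smul]
    congr 1
    ring
  have hf : Orthonormal ℝ f := by
    refine ⟨fun u => ?_, fun u u' hne => ?_⟩
    · have h1 : ‖sgn (d (ψ' u))‖ = 1 := by
        rw [sgn]
        split_ifs <;> simp
      rw [norm_smul, h1, LinearIsometryEquiv.norm_map, hf₀n, one_mul]
    -- For this `b`, `f u` and `f u'` are eigenvectors of the isometry `weyl (φ b)` with opposite
    -- eigenvalues.
    · obtain ⟨b, hb⟩ := exists_dotProduct_ne_zero (sub_ne_zero.2 hne)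
      have h1 := LinearIsometryEquiv.inner_map_map (weyl (φ b)) (f u) (f u')
      have h2 : sgn (b ⬝ᵥ u) * sgn (b ⬝ᵥ u') = -1 := by
        rw [← sgn_add, sgn, if_neg]
        rwa [← dotProduct_add, ← sub_eq_add_U, dotProduct_comm]
      rw [hφf, hφf, real_inner_smul_left, real_inner_smul_right] at h1
      have h3 := sgn_mul_self (c' (φ' b))
      have h4 : (sgn (c' (φ' b)) * sgn (c' (φ' b))) * (sgn (b ⬝ᵥ u) * sgn (b ⬝ᵥ u')) *
          ⟪f u, f u'⟫_ℝ = ⟪f u, f u'⟫_ℝ := by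
        linear_combination h1
      rw [h3, h2] at h4
      linarith
  have hspan : ⊤ ≤ Submodule.span ℝ (Set.range f) :=
    (hf.linearIndependent.span_eq_top_of_card_eq_finrank' (by simp)).ge
  let g : O i := (OrthonormalBasis.mk hf hspan).repr.symm
  have hg : ∀ u, g (e u) = f u := fun u => by
    change (OrthonormalBasis.mk hf hspan).repr.symm (EuclideanSpace.single u 1) = _
    rw [OrthonormalBasis.repr_symm_single, OrthonormalBasis.coe_mk]
  have hext : ∀ A B : V i →ₗ[ℝ] V i, (∀ u, A (e u) = B (e u)) → ∀ v, A v = B v := by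
    intro A B h
    have h1 : A = B := (EuclideanSpace.basisFun (U i) ℝ).toBasis.ext fun u => by
      simpa [e] using h u
    exact fun v => by rw [h1]
  refine ⟨g, mem_cliffordGroup_of_conj hi (fun a => ⟨d (ψ' a), ψ a, ?_⟩)
    (fun b => ⟨c' (φ' b), φ b, ?_⟩), ?_⟩
  · refine hext (g.toLinearEquiv.toLinearMap ∘ₗ (X a).toLinearEquiv.toLinearMap)
      (sgn (d (ψ' a)) • weylLin (ψ a) ∘ₗ g.toLinearEquiv.toLinearMap) fun u => ?_
    change g (X a (e u)) = sgn _ • weyl (ψ a) (g (e u))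
    rw [X_e, hg, hg, hψf, smul_smul, sgn_mul_self, one_smul]
  · refine hext (g.toLinearEquiv.toLinearMap ∘ₗ (Y b).toLinearEquiv.toLinearMap)
      (sgn (c' (φ' b)) • weylLin (φ b) ∘ₗ g.toLinearEquiv.toLinearMap) fun u => ?_
    change g (Y b (e u)) = sgn _ • weyl (φ b) (g (e u))
    rw [Y_e, map_smul, hg, hφf, smul_smul (sgn (c' (φ' b))), ← mul_assoc, sgn_mul_self, one_mul]
  · symm
    apply Submodule.eq_of_le_of_finrank_eq
    · rw [coordSpace, Submodule.map_span, Submodule.span_le]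
      rintro _ ⟨_, ⟨u, hu, rfl⟩, rfl⟩ x
      -- Here `b` is supported on the first `r` coordinates, where `u` vanishes, so `weyl x` acts on
      -- `f u` by the sign of `c x` alone.
      obtain ⟨b, hb, hbx⟩ := hφS x.2
      have hbu : b ⬝ᵥ u = 0 := by
        clear hbx
        induction hb using Submodule.span_induction with
        | mem b hb =>
          obtain ⟨j, hj, rfl⟩ := hb
          rw [single_one_dotProduct, hu j hj]
        | zero => exact zero_dotProduct u
        | add b b' _ _ h h' => rw [add_dotProduct, h, h', add_zero]
        | smul t b _ h => rw [smul_dotProduct, h, smul_zero]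
      have h1 := hφf b u
      rw [hbu, sgn_zero, mul_one] at h1
      change weyl (x : Phase i) (g (e u)) = sgn (c x) • g (e u)
      rw [hg, ← hbx, h1, ← hcc' x]
      congr 3
      exact Subtype.ext hbx
    · rw [hc.finrank_eigenSpace_of_add (hr.symm ▸ hk), LinearEquiv.finrank_map_eq g.toLinearEquiv,
        coordSpace_eq_eigenSpace]
      refine (isSplitting_supportedOn (Finset.disjoint_empty_left _)).finrank_eigenSpace_of_add ?_
      rw [finrank_supportedOn, Finset.card_empty, zero_add, card_firstIndices (by omega), hk]

theorem coordSpace_mem_packing {r : ℕ} (hr : r ≤ i) : coordSpace i r ∈ packing i r :=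
  mem_packing_iff.2 ⟨_, _, by
    rw [finrank_supportedOn, Finset.card_empty, zero_add, card_firstIndices hr],
    isSplitting_supportedOn (Finset.disjoint_empty_left _), coordSpace_eq_eigenSpace r⟩

theorem packing_eq_orbit (hi : 0 < i) {r k : ℕ} (hk : r + k = i) :
    packing i r = orbit (cliffordGroup i) (coordSpace i r) := by
  ext P
  constructor
  · intro hP
    obtain ⟨S, c, hS, hc, rfl⟩ := mem_packing_iff.1 hP
    exact exists_map_coordSpace_eq hi hc hS hk
  · rintro ⟨g, hg, rfl⟩
    exact map_mem_packing hg hk (coordSpace_mem_packing (by omega))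

end CliffordOrbit

/-! ### The lower bound for the distance and a pair attaining it -/

section MinimalDistance

variable {i : ℕ}

theorem finrank_of_mem_packing {r k : ℕ} (hk : r + k = i) {P : Submodule ℝ (V i)}
    (hP : P ∈ packing i r) : Module.finrank ℝ P = 2 ^ k := by
  obtain ⟨S, c, hS, hc, rfl⟩ := mem_packing_iff.1 hP
  exact hc.finrank_eigenSpace_of_add (hS.symm ▸ hk)

theorem le_chordalDist {r k : ℕ} (hk : r + k = i) {P R : Gr (V i) (2 ^ k)}
    (hP : P.1 ∈ packing i r) (hR : R.1 ∈ packing i r) (hne : P ≠ R) :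
    (2 : ℝ) ^ (((k : ℝ) - 1) / 2) ≤ chordalDist P R := by
  obtain ⟨S, c, hS, hc, hPS⟩ := mem_packing_iff.1 hP
  obtain ⟨S', c', hS', hc', hRS⟩ := mem_packing_iff.1 hR
  rw [hc.chordalDist_eq hc' hPS hRS, ← sqrt_two_pow_half]
  have h1 := trace_average_mul_le hk hS hS' hc hc' fun h => hne (Subtype.ext (by
    obtain ⟨rfl, h3⟩ := Sigma.mk.inj_iff.1 h
    rw [hPS, hRS, eq_of_heq h3]))
  apply Real.sqrt_le_sqrt
  push_cast
  linarith

/-- Two totally singular subspaces sharing a hyperplane, both with trivial signs, attain the trace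
bound: one adds `Y` in the direction `j`, the other adds `X` in that direction. -/
theorem exists_chordalDist_eq {r k : ℕ} (hk : r + 1 + k = i) :
    ∃ P R : Gr (V i) (2 ^ k), P.1 ∈ packing i (r + 1) ∧ R.1 ∈ packing i (r + 1) ∧ P ≠ R ∧
      (2 : ℝ) ^ (((k : ℝ) - 1) / 2) = chordalDist P R := by
  let j : Fin i := ⟨r, by omega⟩
  let K := firstIndices i r
  have hK : K.card = r := card_firstIndices (by omega)
  have hjK : j ∉ K := by simp [j, K, mem_firstIndices]
  have hc := isSplitting_supportedOn (Finset.disjoint_empty_left (insert j K))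
  have hc' := isSplitting_supportedOn (Finset.disjoint_singleton_left.2 hjK)
  have hS : Module.finrank (ZMod 2) (supportedOn ∅ (insert j K)) = r + 1 := by
    rw [finrank_supportedOn, Finset.card_insert_of_notMem hjK, hK, Finset.card_empty, zero_add]
  have hS' : Module.finrank (ZMod 2) (supportedOn {j} K) = r + 1 := by
    rw [finrank_supportedOn, hK, Finset.card_singleton, add_comm]
  have hP := mem_packing_iff.2 ⟨_, _, hS, hc, rfl⟩
  have hR := mem_packing_iff.2 ⟨_, _, hS', hc', rfl⟩
  have hm : Module.finrank (ZMod 2)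
      (supportedOn ∅ (insert j K) ⊓ supportedOn {j} K : Submodule (ZMod 2) (Phase i)) = r := by
    rw [supportedOn_inf, Finset.inter_eq_right.2 (Finset.subset_insert j K), finrank_supportedOn,
      Finset.empty_inter, Finset.card_empty, zero_add, hK]
  have hd := hc.chordalDist_eq hc' (P := ⟨_, finrank_of_mem_packing hk hP⟩)
    (R := ⟨_, finrank_of_mem_packing hk hR⟩) rfl rfl
  rw [trace_average_mul_of_eq hk hS hS' hm hc fun _ _ _ => rfl] at hd
  refine ⟨⟨_, finrank_of_mem_packing hk hP⟩, ⟨_, finrank_of_mem_packing hk hR⟩, hP, hR,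
    fun h => ?_, ?_⟩
  rotate_left
  · rw [hd, ← sqrt_two_pow_half, pow_succ]
    push_cast
    congr 2
    field_simp
  · have h1 := eigenSpace_injective hc hc' (hS.trans hS'.symm) (hS.symm ▸ hk)
      (congrArg Subtype.val h)
    have h2 := (Sigma.mk.inj_iff.1 h1).1
    rw [← h2, inf_idem, hS] at hm
    omega

end MinimalDistance

end GrassmannPacking

open GrassmannPacking in
theorem theorem3 (i k : ℕ) (hk : k < i) :
    (∀ P ∈ packing i (i - k), Module.finrank ℝ P = 2 ^ k) ∧
    (packing i (i - k)).Finite ∧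
    ((packing i (i - k)).ncard : ℚ) =
      2 ^ (i - k) * gaussBinom i k * ∏ j ∈ Finset.Icc k (i - 1), ((2 : ℚ) ^ j + 1) ∧
    IsLeast {d : ℝ | ∃ P Q : Gr (V i) (2 ^ k), P.1 ∈ packing i (i - k) ∧
        Q.1 ∈ packing i (i - k) ∧ P ≠ Q ∧ d = chordalDist P Q}
      ((2 : ℝ) ^ (((k : ℝ) - 1) / 2)) ∧
    packing i (i - k) = orbit (cliffordGroup i) (coordSpace i (i - k)) := by
  have h : i - k + k = i := by omega
  refine ⟨fun P hP => finrank_of_mem_packing h hP, finite_packing i _, ?_, ⟨?_, ?_⟩,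
    packing_eq_orbit (by omega) h⟩
  · rw [ncard_packing h]
    push_cast
    rw [card_singularSubspace h (by omega), mul_assoc]
  · obtain ⟨r, hr⟩ : ∃ r, i - k = r + 1 := ⟨i - k - 1, by omega⟩
    rw [hr] at h ⊢
    exact exists_chordalDist_eq h
  · rintro d ⟨P, R, hP, hR, hne, rfl⟩
    exact le_chordalDist h hP hR hne
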